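/- Let $k$ be a field of characteristic $0$, let $V$ be a $k$-vector space and let $\sigma\colon V\otimes V\to V\otimes V$ be a linear map (not assumed invertible) with $(\sigma\otimes\mathrm{id})(\mathrm{id}\otimes\sigma)(\sigma\otimes\mathrm{id})=(\mathrm{id}\otimes\sigma)(\sigma\otimes\mathrm{id})(\mathrm{id}\otimes\sigma)$ on $V^{\otimes 3}$; such a map is called a braiding, and $(V,\sigma)$ a braided vector space. Notation. For a linear endomorphism $\tau$ of $H\otimes H$, write $\tau_1=\tau\otimes\mathrm{id}$ and $\tau_2=\mathrm{id}\otimes\tau$ on $H^{\otimes 3}$, and $\tau_2=\mathrm{id}\otimes\tau\otimes\mathrm{id}$ on $H^{\otimes4}$. A *braided dendriform algebra* is a tuple $(H,\prec,\succ,\tau)$ consisting of a vector space $H$, a braiding $\tau$ on $H$ and linear maps $\prec,\succ\colon H\otimes H\to H$ such that, with $\star:=\prec+\succ$, $$(x\prec y)\prec z=x\prec(y\star z),\qquad (x\succ y)\prec z=x\succ(y\prec z),\qquad x\succ(y\succ z)=(x\star y)\succ z$$ for all $x,y,z\in H$, and for both $\bullet=\prec$ and $\bullet=\succ$ $$\tau(\mathrm{id}\otimes\bullet)=(\bullet\otimes\mathrm{id})\tau_2\tau_1,\qquad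 \tau(\bullet\otimes\mathrm{id})=(\mathrm{id}\otimes\bullet)\tau_1\tau_2 .$$ It is a *braided dendriform Hopf algebra* with a linear map $\tilde\Delta\colon H\to H\otimes H$ if $\tilde\Delta$ is coassociative and $$\tilde\Delta\prec=(\prec\otimes\star)\tau_2(\tilde\Delta\otimes\tilde\Delta)+\bigl(\mathrm{id}\otimes\star+(\prec\otimes\mathrm{id})\tau_2\bigr)(\tilde\Delta\otimes\mathrm{id})+(\prec\otimes\mathrm{id})(\mathrm{id}\otimes\tilde\Delta)+\mathrm{id}_{H\otimes H},$$ $$\tilde\Delta\succ=(\succ\otimes\star)\tau_2(\tilde\Delta\otimes\tilde\Delta)+(\succ\otimes\mathrm{id})\tau_2(\tilde\Delta\otimes\mathrm{id})+\bigl(\succ\otimes\mathrm{id}+(\mathrm{id}\otimes\star)\tau_1\bigr)(\mathrm{id}\otimes\tilde\Delta)+\tau .$$ Let $T(V)=\bigoplus_{n\ge0}V^{\otimes n}$ and $T^+(V)=\bigoplus_{n\ge1}V^{\otimes n}$. Let $\beta$ be the endomorphism of $T(V)\otimes T(V)$ induced by $\sigma$: its restriction $\beta_{m,n}\colon V^{\otimes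 m}\otimes V^{\otimes n}\to V^{\otimes n}\otimes V^{\otimes m}$ is the product of the operators $\sigma_i=\mathrm{id}^{\otimes(i-1)}\otimes\sigma\otimes\mathrm{id}^{\otimes(m+n-i-1)}$ along a reduced expression of the permutation $p\mapsto p+n$ ($p\le m$), $p\mapsto p-m$ ($p>m$), with $\beta_{0,n}$ and $\beta_{m,0}$ the identity. Let $*_\sigma$ be the quantum shuffle product on $T(V)$, that is, the bilinear product with unit $1\in k=V^{\otimes 0}$ determined for $m,n\ge1$, $u\in V^{\otimes m}$, $v\in V^{\otimes n}$ by $u*_\sigma v=u\prec_\sigma v+u\succ_\sigma v$, where $$u\prec_\sigma v=(\mathrm{id}_V\otimes {*_\sigma})(u\otimes v),\qquad u\succ_\sigma v=(\mathrm{id}_V\otimes {*_\sigma})(\beta_{m,1}\otimes\mathrm{id}_V^{\otimes(n-1)})(u\otimes v);$$ here $*_\sigma$ is applied on $V^{\otimes(m-1)}\otimes V^{\otimes n}$ and on $V^{\otimes m}\otimes V^{\otimes(n-1)}$, respectively. Let $\Delta(v_1\otimes\cdots\otimes v_n)=\sum_{i=0}^{n}(v_1\otimes\cdots\otimes v_i)\,\underline\otimes\,(v_{i+1}\otimes\cdots\otimes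 v_n)$ on $T(V)$, let $\bar\Delta(v_1\otimes\cdots\otimes v_n)=\sum_{i=1}^{n-1}(v_1\otimes\cdots\otimes v_i)\,\underline\otimes\,(v_{i+1}\otimes\cdots\otimes v_n)$ on $T^+(V)$, and let $\varepsilon\colon T(V)\to k$ be the projection onto $V^{\otimes0}=k$. **Theorem.** For every braided vector space $(V,\sigma)$, the space $T^+(V)$ with the products $\prec_\sigma,\succ_\sigma$, the reduced deconcatenation coproduct $\bar\Delta$ and the restriction of $\beta$ to $T^+(V)\otimes T^+(V)$ is a braided dendriform Hopf algebra. Moreover $\varepsilon$ is a counit for $(T(V),\Delta)$, its kernel is $T^+(V)$, and $\Delta(x)=x\otimes1+1\otimes x+\bar\Delta(x)$ for all $x\in T^+(V)$. -/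

import Mathlib

open scoped TensorProduct

noncomputable section

namespace BraidedDendriform

universe u v w

/-! ## Braided vector spaces, braided dendriform (Hopf) algebras

Triple tensor powers are bracketed as `H ⊗ (H ⊗ H)`, fourfold ones as `(H ⊗ H) ⊗ (H ⊗ H)`;
the associativity isomorphisms of Mathlib are written out. -/

section Abstract

variable {k : Type u} [CommRing k] {H : Type v} [AddCommGroup H] [Module k H]

/-- `σ ⊗ id_N` on `H ⊗ H ⊗ N`. -/
def braidFirst (σ : H ⊗[k] H →ₗ[k] H ⊗[k] H) (N : Type w) [AddCommGroup N] [Module k N] :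
    H ⊗[k] (H ⊗[k] N) →ₗ[k] H ⊗[k] (H ⊗[k] N) :=
  (TensorProduct.assoc k H H N).toLinearMap ∘ₗ σ.rTensor N ∘ₗ
    (TensorProduct.assoc k H H N).symm.toLinearMap

/-- `σ₁ = σ ⊗ id` on `H ⊗ H ⊗ H`. -/
def braid₁ (σ : H ⊗[k] H →ₗ[k] H ⊗[k] H) : H ⊗[k] (H ⊗[k] H) →ₗ[k] H ⊗[k] (H ⊗[k] H) :=
  braidFirst σ H

/-- `σ₂ = id ⊗ σ` on `H ⊗ H ⊗ H`. -/
def braid₂ (σ : H ⊗[k] H →ₗ[k] H ⊗[k] H) : H ⊗[k] (H ⊗[k] H) →ₗ[k] H ⊗[k] (H ⊗[k] H) :=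
  σ.lTensor H

/-- `σ₂ = id ⊗ σ ⊗ id` on `H ⊗ H ⊗ H ⊗ H`. -/
def braidMid (σ : H ⊗[k] H →ₗ[k] H ⊗[k] H) :
    (H ⊗[k] H) ⊗[k] (H ⊗[k] H) →ₗ[k] (H ⊗[k] H) ⊗[k] (H ⊗[k] H) :=
  (TensorProduct.assoc k H H (H ⊗[k] H)).symm.toLinearMap ∘ₗ (braidFirst σ H).lTensor H ∘ₗ
    (TensorProduct.assoc k H H (H ⊗[k] H)).toLinearMap

/-- `m ⊗ id : H ⊗ H ⊗ H → H ⊗ H` for a product `m`. -/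
def mulLeft (m : H ⊗[k] H →ₗ[k] H) : H ⊗[k] (H ⊗[k] H) →ₗ[k] H ⊗[k] H :=
  m.rTensor H ∘ₗ (TensorProduct.assoc k H H H).symm.toLinearMap

/-- `id ⊗ m : H ⊗ H ⊗ H → H ⊗ H` for a product `m`. -/
def mulRight (m : H ⊗[k] H →ₗ[k] H) : H ⊗[k] (H ⊗[k] H) →ₗ[k] H ⊗[k] H :=
  m.lTensor H

/-- `Δ ⊗ id : H ⊗ H → H ⊗ H ⊗ H` for a coproduct `Δ`. -/
def comulLeft (Δ : H →ₗ[k] H ⊗[k] H) : H ⊗[k] H →ₗ[k] H ⊗[k] (H ⊗[k] H) :=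
  (TensorProduct.assoc k H H H).toLinearMap ∘ₗ Δ.rTensor H

/-- `id ⊗ Δ : H ⊗ H → H ⊗ H ⊗ H` for a coproduct `Δ`. -/
def comulRight (Δ : H →ₗ[k] H ⊗[k] H) : H ⊗[k] H →ₗ[k] H ⊗[k] (H ⊗[k] H) :=
  Δ.lTensor H

/-- `σ` is a braiding (Yang-Baxter operator), not required to be invertible. -/
def IsBraiding (σ : H ⊗[k] H →ₗ[k] H ⊗[k] H) : Prop :=
  braid₁ σ ∘ₗ braid₂ σ ∘ₗ braid₁ σ = braid₂ σ ∘ₗ braid₁ σ ∘ₗ braid₂ σ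

/-- `(H, ≺, ≻)` is a dendriform algebra. -/
structure IsDendriform (prec succ : H ⊗[k] H →ₗ[k] H) : Prop where
  prec_prec : ∀ x y z : H,
    prec (prec (x ⊗ₜ y) ⊗ₜ z) = prec (x ⊗ₜ (prec (y ⊗ₜ z) + succ (y ⊗ₜ z)))
  succ_prec : ∀ x y z : H,
    prec (succ (x ⊗ₜ y) ⊗ₜ z) = succ (x ⊗ₜ prec (y ⊗ₜ z))
  succ_succ : ∀ x y z : H,
    succ (x ⊗ₜ succ (y ⊗ₜ z)) = succ ((prec (x ⊗ₜ y) + succ (x ⊗ₜ y)) ⊗ₜ z)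

/-- `(H, ≺, ≻, σ)` is a braided dendriform algebra. -/
structure IsBraidedDendriform (prec succ : H ⊗[k] H →ₗ[k] H)
    (σ : H ⊗[k] H →ₗ[k] H ⊗[k] H) : Prop where
  isBraiding : IsBraiding σ
  isDendriform : IsDendriform prec succ
  braid_id_prec : σ ∘ₗ mulRight prec = mulLeft prec ∘ₗ braid₂ σ ∘ₗ braid₁ σ
  braid_prec_id : σ ∘ₗ mulLeft prec = mulRight prec ∘ₗ braid₁ σ ∘ₗ braid₂ σ
  braid_id_succ : σ ∘ₗ mulRight succ = mulLeft succ ∘ₗ braid₂ σ ∘ₗ braid₁ σ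
  braid_succ_id : σ ∘ₗ mulLeft succ = mulRight succ ∘ₗ braid₁ σ ∘ₗ braid₂ σ

/-- `(H, ≺, ≻, Δ, σ)` is a braided dendriform Hopf algebra; here `⋆ = ≺ + ≻`. -/
structure IsBraidedDendriformHopf (prec succ : H ⊗[k] H →ₗ[k] H) (Δ : H →ₗ[k] H ⊗[k] H)
    (σ : H ⊗[k] H →ₗ[k] H ⊗[k] H) : Prop where
  isBraidedDendriform : IsBraidedDendriform prec succ σ
  coassoc : comulLeft Δ ∘ₗ Δ = comulRight Δ ∘ₗ Δ
  comul_prec :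
    Δ ∘ₗ prec =
      TensorProduct.map prec (prec + succ) ∘ₗ braidMid σ ∘ₗ TensorProduct.map Δ Δ
      + (mulRight (prec + succ) + mulLeft prec ∘ₗ braid₂ σ) ∘ₗ comulLeft Δ
      + mulLeft prec ∘ₗ comulRight Δ
      + LinearMap.id
  comul_succ :
    Δ ∘ₗ succ =
      TensorProduct.map succ (prec + succ) ∘ₗ braidMid σ ∘ₗ TensorProduct.map Δ Δ
      + (mulLeft succ ∘ₗ braid₂ σ) ∘ₗ comulLeft Δ
      + (mulLeft succ + mulRight (prec + succ) ∘ₗ braid₁ σ) ∘ₗ comulRight Δ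
      + σ

end Abstract

/-! ## The tensor space

`T(V)` is Mathlib's `TensorAlgebra k V`, used as the vector space `⨁ V^{⊗ n}`: the element
`v₁ ⊗ ⋯ ⊗ vₙ` is the product `ι v₁ * ⋯ * ι vₙ`, and `ι v * t` is `v ⊗ t`. -/

section Words

variable {k : Type u} [CommRing k] {V : Type v} [AddCommGroup V] [Module k V]
variable {M : Type w} [AddCommGroup M] [Module k M]

variable (k) in
/-- The word `v₁ ⊗ ⋯ ⊗ vₙ` in `T(V)`. -/
def word (l : List V) : TensorAlgebra k V := (l.map (TensorAlgebra.ι k)).prod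

@[simp] lemma word_nil : word k ([] : List V) = 1 := rfl

@[simp] lemma word_cons (a : V) (l : List V) :
    word k (a :: l) = TensorAlgebra.ι k a * word k l := by simp [word]

lemma word_append (l l' : List V) : word k (l ++ l') = word k l * word k l' := by simp [word]

/-- Induction on the length of tensors. -/
lemma cons_induction {p : TensorAlgebra k V → Prop} (one : p 1)
    (cons : ∀ a t, p t → p (TensorAlgebra.ι k a * t))
    (add : ∀ s t, p s → p t → p (s + t)) (smul : ∀ (c : k) t, p t → p (c • t)) (t) : p t := by
  have key : ∀ x t, p t → p (x * t) := by
    intro x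
    induction x using TensorAlgebra.induction with
    | algebraMap r => intro t ht; rw [← Algebra.smul_def]; exact smul r t ht
    | ι a => exact fun t ht => cons a t ht
    | mul x y hx hy => intro t ht; rw [mul_assoc]; exact hx _ (hy _ ht)
    | add x y hx hy => intro t ht; rw [add_mul]; exact add _ _ (hx _ ht) (hy _ ht)
  simpa using key t 1 one

/-- The linear map `f` on `T(V)` with `f 1 = m` and `f (a ⊗ t) = s a (f t)`. -/
def fold (m : M) (s : V →ₗ[k] M →ₗ[k] M) : TensorAlgebra k V →ₗ[k] M :=
  LinearMap.applyₗ m ∘ₗ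
    (TensorAlgebra.lift k (s : V →ₗ[k] Module.End k M)).toLinearMap

@[simp] lemma fold_one (m : M) (s : V →ₗ[k] M →ₗ[k] M) : fold m s 1 = m := by
  simp [fold]

@[simp] lemma fold_cons (m : M) (s : V →ₗ[k] M →ₗ[k] M) (a : V) (t : TensorAlgebra k V) :
    fold m s (TensorAlgebra.ι k a * t) = s a (fold m s t) := by
  simp [fold]

/-- The linear map `f` on `T(V)` with `f 1 = m` and `f (a ⊗ t) = s a (t, f t)`. -/
def primRec (m : M) (s : V →ₗ[k] (TensorAlgebra k V × M) →ₗ[k] M) :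
    TensorAlgebra k V →ₗ[k] M :=
  LinearMap.snd k _ _ ∘ₗ fold ((1 : TensorAlgebra k V), m)
    (LinearMap.mk₂ k (fun a x => (TensorAlgebra.ι k a * x.1, s a x))
      (by intros; simp [add_mul]) (by intros; simp)
      (by intros; simp [mul_add]) (by intros; simp))

@[simp] lemma primRec_one (m : M) (s : V →ₗ[k] (TensorAlgebra k V × M) →ₗ[k] M) :
    primRec m s 1 = m := by
  simp [primRec]

@[simp] lemma primRec_cons (m : M) (s : V →ₗ[k] (TensorAlgebra k V × M) →ₗ[k] M)
    (a : V) (t : TensorAlgebra k V) :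
    primRec m s (TensorAlgebra.ι k a * t) = s a (t, primRec m s t) := by
  have h : ∀ t : TensorAlgebra k V, (fold ((1 : TensorAlgebra k V), m)
      (LinearMap.mk₂ k (fun a x => (TensorAlgebra.ι k a * x.1, s a x))
      (by intros; simp [add_mul]) (by intros; simp)
      (by intros; simp [mul_add]) (by intros; simp)) t).1 = t := by
    intro t
    induction t using cons_induction with
    | one => simp
    | cons a t ht => simp [ht]
    | add x y hx hy => simp [hx, hy]
    | smul c x hx => simp [hx]
  simp only [primRec, LinearMap.comp_apply, fold_cons, LinearMap.mk₂_apply, LinearMap.snd_apply]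
  congr 1
  exact Prod.ext (h t) rfl

variable (k V) in
/-- The space `T⁺(V) = ⨁_{n ≥ 1} V^{⊗ n}`, realised as `V ⊗ T(V)`. -/
abbrev TPlus : Type (max u v) := V ⊗[k] TensorAlgebra k V

variable (k V) in
/-- The inclusion `T⁺(V) → T(V)`. -/
def incl : TPlus k V →ₗ[k] TensorAlgebra k V :=
  TensorProduct.lift ((LinearMap.mul k (TensorAlgebra k V)).comp (TensorAlgebra.ι k))

@[simp] lemma incl_tmul (a : V) (t : TensorAlgebra k V) :
    incl k V (a ⊗ₜ t) = TensorAlgebra.ι k a * t := by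
  simp [incl]

variable (k V) in
/-- The projection `T(V) → T⁺(V)` along `V^{⊗ 0}`. -/
def proj : TensorAlgebra k V →ₗ[k] TPlus k V :=
  primRec 0 ((LinearMap.lcomp k _ (LinearMap.fst k _ _)) ∘ₗ TensorProduct.mk k V _)

@[simp] lemma proj_one : proj k V 1 = 0 := by simp [proj]

@[simp] lemma proj_cons (a : V) (t : TensorAlgebra k V) :
    proj k V (TensorAlgebra.ι k a * t) = a ⊗ₜ t := by
  simp [proj]

variable (k V) in
/-- The counit `ε`: identity on `V^{⊗ 0} = k`, zero on `V^{⊗ n}` for `n ≥ 1`. -/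
def counit : TensorAlgebra k V →ₗ[k] k := TensorAlgebra.algebraMapInv.toLinearMap

@[simp] lemma counit_one : counit k V 1 = 1 := by simp [counit]

@[simp] lemma counit_cons (a : V) (t : TensorAlgebra k V) :
    counit k V (TensorAlgebra.ι k a * t) = 0 := by
  simp [counit, TensorAlgebra.algebraMapInv]

lemma proj_incl (x : TPlus k V) : proj k V (incl k V x) = x := by
  induction x using TensorProduct.induction_on with
  | zero => simp
  | tmul a t => simp
  | add x y hx hy => simp [hx, hy]

lemma incl_proj (t : TensorAlgebra k V) :
    incl k V (proj k V t) = t - counit k V t • (1 : TensorAlgebra k V) := by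
  induction t using cons_induction with
  | one => simp
  | cons a t ht => simp
  | add x y hx hy => simp [hx, hy, add_smul]; abel
  | smul c x hx => simp [hx, smul_sub, mul_smul]

/-- `T⁺(V)` is identified with the kernel of the counit. -/
lemma range_incl : LinearMap.range (incl k V) = LinearMap.ker (counit k V) := by
  ext t
  constructor
  · rintro ⟨x, rfl⟩
    induction x using TensorProduct.induction_on with
    | zero => simp
    | tmul a u => simp
    | add x y hx hy => rw [map_add]; exact Submodule.add_mem _ hx hy
  · intro h
    exact ⟨proj k V t, by rw [incl_proj, LinearMap.mem_ker.1 h]; simp⟩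

/-- The deconcatenation coproduct on `T(V)`. -/
def deconcat : TensorAlgebra k V →ₗ[k] TensorAlgebra k V ⊗[k] TensorAlgebra k V :=
  primRec (1 ⊗ₜ 1)
    (LinearMap.mk₂ k (fun a x => 1 ⊗ₜ (TensorAlgebra.ι k a * x.1)
        + (LinearMap.mul k _ (TensorAlgebra.ι k a)).rTensor _ x.2)
      (by intro a b x; simp [add_mul, TensorProduct.tmul_add, LinearMap.rTensor_add]; abel)
      (by intro c a x; simp [LinearMap.rTensor_smul])
      (by intro a x y; simp [mul_add, TensorProduct.tmul_add]; abel)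
      (by intro c a x; simp))

@[simp] lemma deconcat_one : deconcat (1 : TensorAlgebra k V) = 1 ⊗ₜ 1 := by simp [deconcat]

@[simp] lemma deconcat_cons (a : V) (t : TensorAlgebra k V) :
    deconcat (TensorAlgebra.ι k a * t) = 1 ⊗ₜ (TensorAlgebra.ι k a * t)
      + (LinearMap.mul k _ (TensorAlgebra.ι k a)).rTensor _ (deconcat t) := by
  simp [deconcat]

/-- `Δ(v₁ ⋯ vₙ) = ∑_{i=0}^{n} (v₁ ⋯ vᵢ) ⊗ (vᵢ₊₁ ⋯ vₙ)`. -/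
lemma deconcat_word (l : List V) :
    deconcat (word k l) = ∑ i ∈ Finset.range (l.length + 1),
      word k (l.take i) ⊗ₜ[k] word k (l.drop i) := by
  induction l with
  | nil => simp
  | cons a l ih =>
    rw [word_cons, deconcat_cons, ih, List.length_cons, Finset.sum_range_succ' _ (l.length + 1)]
    simp [add_comm]

variable (k V) in
/-- The reduced deconcatenation coproduct on `T⁺(V)`: deconcatenation without the two terms
having a factor in `V^{⊗ 0}`. -/
def reducedDeconcat : TPlus k V →ₗ[k] TPlus k V ⊗[k] TPlus k V :=
  TensorProduct.map (proj k V) (proj k V) ∘ₗ deconcat ∘ₗ incl k V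

/-- `Δ̄(v₁ ⋯ vₙ) = ∑_{i=1}^{n-1} (v₁ ⋯ vᵢ) ⊗ (vᵢ₊₁ ⋯ vₙ)`. -/
lemma reducedDeconcat_word (l : List V) :
    TensorProduct.map (incl k V) (incl k V) (reducedDeconcat k V (proj k V (word k l))) =
      ∑ i ∈ Finset.Ico 1 l.length, word k (l.take i) ⊗ₜ[k] word k (l.drop i) := by
  have hone : ∀ l : List V, l ≠ [] → incl k V (proj k V (word k l)) = word k l := by
    rintro (_ | ⟨a, l⟩) h
    · simp at h
    · simp
  rcases l with _ | ⟨a, l⟩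
  · simp
  · have h : incl k V (proj k V (word k (a :: l))) = word k (a :: l) := hone _ (by simp)
    rw [reducedDeconcat, LinearMap.comp_apply, LinearMap.comp_apply, h, deconcat_word, map_sum,
      map_sum, List.length_cons, Finset.sum_range_succ, Finset.range_eq_Ico,
      Finset.sum_eq_sum_Ico_succ_bot (by omega)]
    simp only [List.take_zero, word_nil, List.drop_zero, TensorProduct.map_tmul, proj_one,
      TensorProduct.zero_tmul, zero_add, map_zero]
    rw [show (a :: l).drop (l.length + 1) = [] by simp]
    simp only [word_nil, proj_one, TensorProduct.tmul_zero, map_zero, add_zero]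
    refine Finset.sum_congr rfl fun i hi => ?_
    rw [Finset.mem_Ico] at hi
    rw [hone _ (by rw [← List.length_pos_iff]; simp; omega),
      hone _ (by rw [← List.length_pos_iff]; simp; omega)]

end Words

/-! ## The braiding `β`, the quantum shuffle product and its two halves -/

section QuantumShuffle

variable {k : Type u} [CommRing k] {V : Type v} [AddCommGroup V] [Module k V]

/-- `x ↦ (σ ⊗ id)(b ⊗ x)` for `x ∈ V ⊗ T(V)`, regarded again as an element of `V ⊗ T(V)`. -/
def stepBraid (σ : V ⊗[k] V →ₗ[k] V ⊗[k] V) (b : V) : TPlus k V →ₗ[k] TPlus k V :=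
  (incl k V).lTensor V ∘ₗ braidFirst σ (TensorAlgebra k V) ∘ₗ TensorProduct.mk k V (TPlus k V) b

/-- The linear map `u ↦ (a ↦ β_{m,1}(u ⊗ a)) : V^{⊗ m} → Hom(V, V ⊗ V^{⊗ m})`, with
`β_{0,1} = id` and `β_{m+1,1} = (σ ⊗ id)(id ⊗ β_{m,1})`, so that `β_{m,1} = σ₁ σ₂ ⋯ σₘ`. -/
def letterBraidFlip (σ : V ⊗[k] V →ₗ[k] V ⊗[k] V) :
    TensorAlgebra k V →ₗ[k] V →ₗ[k] TPlus k V :=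
  fold ((TensorProduct.mk k V (TensorAlgebra k V)).flip 1)
    (LinearMap.mk₂ k (fun b f => stepBraid σ b ∘ₗ f)
      (by intros; ext; simp [stepBraid])
      (by intros; ext; simp [stepBraid])
      (by intros; ext; simp)
      (by intros; ext; simp))

/-- `letterBraid σ a u = β_{m,1}(u ⊗ a)` for `u ∈ V^{⊗ m}`, in `V ⊗ V^{⊗ m}`. -/
def letterBraid (σ : V ⊗[k] V →ₗ[k] V ⊗[k] V) :
    V →ₗ[k] TensorAlgebra k V →ₗ[k] TPlus k V :=
  (letterBraidFlip σ).flip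

@[simp] lemma letterBraid_one (σ : V ⊗[k] V →ₗ[k] V ⊗[k] V) (a : V) :
    letterBraid σ a 1 = a ⊗ₜ 1 := by
  simp [letterBraid, letterBraidFlip]

@[simp] lemma letterBraid_cons (σ : V ⊗[k] V →ₗ[k] V ⊗[k] V) (a b : V) (u : TensorAlgebra k V) :
    letterBraid σ a (TensorAlgebra.ι k b * u) =
      (incl k V).lTensor V (braidFirst σ (TensorAlgebra k V) (b ⊗ₜ letterBraid σ a u)) := by
  simp [letterBraid, letterBraidFlip, stepBraid]

/-- The linear map `v ↦ (u ↦ β(u ⊗ v))`, with `β_{m,0} = id` and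
`β_{m,1+n} = (id_V ⊗ β_{m,n})(β_{m,1} ⊗ id)`. -/
def braidFlip (σ : V ⊗[k] V →ₗ[k] V ⊗[k] V) :
    TensorAlgebra k V →ₗ[k] TensorAlgebra k V →ₗ[k] TensorAlgebra k V ⊗[k] TensorAlgebra k V :=
  fold (TensorProduct.mk k (TensorAlgebra k V) (TensorAlgebra k V) 1)
    (LinearMap.mk₂ k (fun a f => (incl k V).rTensor (TensorAlgebra k V) ∘ₗ
        (TensorProduct.assoc k V (TensorAlgebra k V) (TensorAlgebra k V)).symm.toLinearMap ∘ₗ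
        f.lTensor V ∘ₗ letterBraid σ a)
      (by intros; simp [LinearMap.comp_add])
      (by intros; simp [LinearMap.comp_smul])
      (by intros; simp [LinearMap.comp_add, LinearMap.add_comp, LinearMap.lTensor_add])
      (by intros; simp [LinearMap.comp_smul, LinearMap.smul_comp, LinearMap.lTensor_smul]))

/-- The braiding `β` of `T(V)` induced by `σ`: its restriction `β_{m,n}` to
`V^{⊗ m} ⊗ V^{⊗ n}` is the lift `T^σ_χ` of the block transposition `χ` in `𝔖_{m+n}`, computed by
the reduced expression `χ = (s_n ⋯ s_{n+m-1}) ⋯ (s_2 ⋯ s_{m+1}) (s_1 ⋯ s_m)`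
of length `m n`. See `braidT_word`. -/
def braidT (σ : V ⊗[k] V →ₗ[k] V ⊗[k] V) :
    TensorAlgebra k V ⊗[k] TensorAlgebra k V →ₗ[k] TensorAlgebra k V ⊗[k] TensorAlgebra k V :=
  TensorProduct.lift (braidFlip σ).flip

@[simp] lemma braidT_one_right (σ : V ⊗[k] V →ₗ[k] V ⊗[k] V) (t : TensorAlgebra k V) :
    braidT σ (t ⊗ₜ 1) = 1 ⊗ₜ t := by
  simp [braidT, braidFlip]

lemma braidT_cons_right (σ : V ⊗[k] V →ₗ[k] V ⊗[k] V) (u : TensorAlgebra k V) (a : V)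
    (t : TensorAlgebra k V) :
    braidT σ (u ⊗ₜ (TensorAlgebra.ι k a * t)) =
      (incl k V).rTensor (TensorAlgebra k V)
        ((TensorProduct.assoc k V (TensorAlgebra k V) (TensorAlgebra k V)).symm
          ((braidT σ ∘ₗ (TensorProduct.mk k _ _).flip t).lTensor V (letterBraid σ a u))) := by
  have : braidT σ ∘ₗ (TensorProduct.mk k _ _).flip t = braidFlip σ t := by
    ext; simp [braidT]
  rw [this]
  simp [braidT, braidFlip]

/-- `σ_{i+1} = id^{⊗ i} ⊗ σ ⊗ id` on the tensors of length at least `i + 2`. -/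
def sigmaAt (σ : V ⊗[k] V →ₗ[k] V ⊗[k] V) : ℕ → Module.End k (TensorAlgebra k V)
  | 0 => incl k V ∘ₗ (incl k V).lTensor V ∘ₗ braidFirst σ (TensorAlgebra k V) ∘ₗ
      (proj k V).lTensor V ∘ₗ proj k V
  | i + 1 => incl k V ∘ₗ (sigmaAt σ i).lTensor V ∘ₗ proj k V

/-- The list of indices, counted from `0`, of the reduced expression
`(s_n ⋯ s_{n+m-1}) ⋯ (s_2 ⋯ s_{m+1}) (s_1 ⋯ s_m)`. -/
def blockWord (m : ℕ) : ℕ → List ℕ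
  | 0 => []
  | n + 1 => (blockWord m n).map Nat.succ ++ List.range m

lemma sigmaAt_succ_cons (σ : V ⊗[k] V →ₗ[k] V ⊗[k] V) (i : ℕ) (b : V) (t : TensorAlgebra k V) :
    sigmaAt σ (i + 1) (TensorAlgebra.ι k b * t) = TensorAlgebra.ι k b * sigmaAt σ i t := by
  simp [sigmaAt]

lemma sigmaAt_succ_list (σ : V ⊗[k] V →ₗ[k] V ⊗[k] V) (is : List ℕ) (b : V)
    (t : TensorAlgebra k V) :
    ((is.map Nat.succ).map (sigmaAt σ)).prod (TensorAlgebra.ι k b * t) =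
      TensorAlgebra.ι k b * (is.map (sigmaAt σ)).prod t := by
  induction is with
  | nil => simp
  | cons i is ih =>
    rw [List.map_cons, List.map_cons, List.prod_cons, Module.End.mul_apply, ih]
    simp [sigmaAt_succ_cons]

lemma sigmaAt_zero_mul (σ : V ⊗[k] V →ₗ[k] V ⊗[k] V) (b : V) (x : TPlus k V)
    (t : TensorAlgebra k V) :
    incl k V ((incl k V).lTensor V (braidFirst σ (TensorAlgebra k V) (b ⊗ₜ x))) * t =
      sigmaAt σ 0 (TensorAlgebra.ι k b * (incl k V x * t)) := by
  induction x using TensorProduct.induction_on with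
  | zero => simp
  | add x y hx hy => simp only [TensorProduct.tmul_add, map_add, add_mul, hx, hy, mul_add]
  | tmul c u =>
    simp only [incl_tmul, mul_assoc, sigmaAt, LinearMap.comp_apply, proj_cons,
      LinearMap.lTensor_tmul, braidFirst, LinearEquiv.coe_coe, TensorProduct.assoc_symm_tmul,
      LinearMap.rTensor_tmul]
    induction σ (b ⊗ₜ c) using TensorProduct.induction_on with
    | zero => simp
    | add x y hx hy => simp only [TensorProduct.add_tmul, map_add, add_mul, hx, hy]
    | tmul x y => simp [mul_assoc]

lemma letterBraid_word (σ : V ⊗[k] V →ₗ[k] V ⊗[k] V) (a : V) (l : List V)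
    (t : TensorAlgebra k V) :
    incl k V (letterBraid σ a (word k l)) * t =
      ((List.range l.length).map (sigmaAt σ)).prod (word k l * (TensorAlgebra.ι k a * t)) := by
  induction l with
  | nil => simp
  | cons b l ih =>
    rw [word_cons, letterBraid_cons, sigmaAt_zero_mul, ih, List.length_cons,
      List.range_succ_eq_map, List.map_cons, List.prod_cons, Module.End.mul_apply, mul_assoc,
      sigmaAt_succ_list]

lemma letterBraid_mem (σ : V ⊗[k] V →ₗ[k] V ⊗[k] V) (a : V) (l : List V) :
    letterBraid σ a (word k l) ∈ Submodule.span k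
      {x : TPlus k V | ∃ (b : V) (l' : List V), l'.length = l.length ∧ b ⊗ₜ word k l' = x} := by
  induction l with
  | nil => exact Submodule.subset_span ⟨a, [], rfl, by simp⟩
  | cons b l ih =>
    rw [word_cons, letterBraid_cons]
    generalize letterBraid σ a (word k l) = z at ih ⊢
    induction ih using Submodule.span_induction with
    | zero => simp
    | add x y _ _ hx hy =>
      simp only [TensorProduct.tmul_add, map_add]; exact Submodule.add_mem _ hx hy
    | smul c x _ hx => simp only [TensorProduct.tmul_smul, map_smul]; exact Submodule.smul_mem _ c hx
    | mem x hx =>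
      obtain ⟨c, l', hl, rfl⟩ := hx
      simp only [braidFirst, LinearMap.comp_apply, LinearEquiv.coe_coe,
        TensorProduct.assoc_symm_tmul, LinearMap.rTensor_tmul]
      induction σ (b ⊗ₜ c) using TensorProduct.induction_on with
      | zero => simp
      | add x y hx hy =>
        simp only [TensorProduct.add_tmul, map_add]; exact Submodule.add_mem _ hx hy
      | tmul x y => exact Submodule.subset_span ⟨x, y :: l', by simp [hl], by simp⟩

/-- Under concatenation, `β_{m,n}` is the product of the operators `σ_i` along the reduced
expression `blockWord m n` of the block transposition. -/
lemma braidT_word (σ : V ⊗[k] V →ₗ[k] V ⊗[k] V) (l l' : List V) :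
    LinearMap.mul' k _ (braidT σ (word k l ⊗ₜ word k l')) =
      ((blockWord l.length l'.length).map (sigmaAt σ)).prod (word k (l ++ l')) := by
  induction l' generalizing l with
  | nil => simp [blockWord]
  | cons a l' ih =>
    have key : ∀ x ∈ Submodule.span k
        {x : TPlus k V | ∃ (b : V) (l₁ : List V), l₁.length = l.length ∧ b ⊗ₜ word k l₁ = x},
        LinearMap.mul' k _ ((incl k V).rTensor (TensorAlgebra k V)
          ((TensorProduct.assoc k V (TensorAlgebra k V) (TensorAlgebra k V)).symm
            ((braidT σ ∘ₗ (TensorProduct.mk k _ _).flip (word k l')).lTensor V x))) =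
        (((blockWord l.length l'.length).map Nat.succ).map (sigmaAt σ)).prod
          (incl k V x * word k l') := by
      intro x hx
      induction hx using Submodule.span_induction with
      | zero => simp
      | add x y _ _ hx hy => simp only [map_add, add_mul, hx, hy]
      | smul c x _ hx => simp only [map_smul, smul_mul_assoc, hx]
      | mem x hx =>
        obtain ⟨b, l₁, hl, rfl⟩ := hx
        have h := ih l₁
        rw [word_append, hl] at h
        rw [incl_tmul, mul_assoc, sigmaAt_succ_list, ← h]
        simp only [LinearMap.lTensor_tmul, LinearMap.comp_apply, LinearMap.flip_apply,
          TensorProduct.mk_apply]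
        induction braidT σ (word k l₁ ⊗ₜ word k l') using TensorProduct.induction_on with
        | zero => simp
        | add x y hx hy => simp only [TensorProduct.tmul_add, map_add, mul_add, hx, hy]
        | tmul x y => simp [mul_assoc]
    rw [word_cons, braidT_cons_right, key _ (letterBraid_mem σ a l), letterBraid_word,
      List.length_cons, blockWord, List.map_append, List.prod_append, Module.End.mul_apply,
      word_append, word_cons]

/-- The braiding `β` restricted to `T⁺(V)`. -/
def braidTPlus (σ : V ⊗[k] V →ₗ[k] V ⊗[k] V) :
    TPlus k V ⊗[k] TPlus k V →ₗ[k] TPlus k V ⊗[k] TPlus k V :=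
  TensorProduct.map (proj k V) (proj k V) ∘ₗ braidT σ ∘ₗ
    TensorProduct.map (incl k V) (incl k V)

lemma incl_proj_comp_incl : (incl k V ∘ₗ proj k V) ∘ₗ incl k V = incl k V := by
  refine LinearMap.ext fun x => ?_
  simp only [LinearMap.comp_apply, proj_incl]

lemma braidT_incl_left (σ : V ⊗[k] V →ₗ[k] V ⊗[k] V) (x : TPlus k V) (t : TensorAlgebra k V) :
    (incl k V ∘ₗ proj k V).lTensor (TensorAlgebra k V) (braidT σ (incl k V x ⊗ₜ t)) =
      braidT σ (incl k V x ⊗ₜ t) := by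
  induction t using cons_induction generalizing x with
  | one => simp [proj_incl]
  | add s t hs ht => simp only [TensorProduct.tmul_add, map_add, hs, ht]
  | smul c t ht => simp only [TensorProduct.tmul_smul, map_smul, ht]
  | cons a t ih =>
    have hz : ∃ z : V ⊗[k] TPlus k V,
        letterBraid σ a (incl k V x) = (incl k V).lTensor V z := by
      induction x using TensorProduct.induction_on with
      | zero => exact ⟨0, by simp⟩
      | tmul b u => exact ⟨_, by rw [incl_tmul, letterBraid_cons]⟩
      | add x y hx hy =>
        obtain ⟨z, hz⟩ := hx
        obtain ⟨w, hw⟩ := hy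
        exact ⟨z + w, by rw [map_add, map_add, map_add, hz, hw]⟩
    obtain ⟨z, hz⟩ := hz
    rw [braidT_cons_right, hz]
    clear hz
    induction z using TensorProduct.induction_on with
    | zero => simp
    | add x y hx hy => simp only [map_add, hx, hy]
    | tmul b y =>
      simp only [LinearMap.lTensor_tmul, LinearMap.coe_comp, Function.comp_apply,
        LinearMap.flip_apply, TensorProduct.mk_apply]
      conv_rhs => rw [← ih y]
      induction braidT σ (incl k V y ⊗ₜ t) using TensorProduct.induction_on with
      | zero => simp
      | add x y hx hy => simp only [TensorProduct.tmul_add, map_add, hx, hy]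
      | tmul x y => simp

lemma braidT_incl_right (σ : V ⊗[k] V →ₗ[k] V ⊗[k] V) (t : TensorAlgebra k V) (x : TPlus k V) :
    (incl k V ∘ₗ proj k V).rTensor (TensorAlgebra k V) (braidT σ (t ⊗ₜ incl k V x)) =
      braidT σ (t ⊗ₜ incl k V x) := by
  induction x using TensorProduct.induction_on with
  | zero => simp
  | add x y hx hy => simp only [TensorProduct.tmul_add, map_add, hx, hy]
  | tmul a u =>
    rw [incl_tmul, braidT_cons_right, ← LinearMap.comp_apply, ← LinearMap.rTensor_comp,
      incl_proj_comp_incl]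

/-- `β` maps `T⁺(V) ⊗ T⁺(V)` to itself, and `braidTPlus σ` is its restriction. -/
lemma map_incl_braidTPlus (σ : V ⊗[k] V →ₗ[k] V ⊗[k] V) (x y : TPlus k V) :
    TensorProduct.map (incl k V) (incl k V) (braidTPlus σ (x ⊗ₜ y)) =
      braidT σ (incl k V x ⊗ₜ incl k V y) := by
  conv_rhs => rw [← braidT_incl_left, ← braidT_incl_right]
  rw [← LinearMap.comp_apply (LinearMap.lTensor _ _), LinearMap.lTensor_comp_rTensor,
    TensorProduct.map_comp]
  simp [braidTPlus]

/-- For a linear map `h` on `T(V)`, the linear map `g` with `g 1 = h 1` and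
`g (b ⊗ u) = b ⊗ g u + h (b ⊗ u)`. -/
def shuffleRec (h : TensorAlgebra k V →ₗ[k] TensorAlgebra k V) :
    TensorAlgebra k V →ₗ[k] TensorAlgebra k V :=
  primRec (h 1) (LinearMap.mk₂ k
    (fun b x => TensorAlgebra.ι k b * x.2 + h (TensorAlgebra.ι k b * x.1))
    (by intros; simp [add_mul]; abel) (by intros; simp)
    (by intros; simp [mul_add]; abel) (by intros; simp))

@[simp] lemma shuffleRec_one (h : TensorAlgebra k V →ₗ[k] TensorAlgebra k V) :
    shuffleRec h 1 = h 1 := by simp [shuffleRec]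

@[simp] lemma shuffleRec_cons (h : TensorAlgebra k V →ₗ[k] TensorAlgebra k V) (b : V)
    (u : TensorAlgebra k V) : shuffleRec h (TensorAlgebra.ι k b * u) =
      TensorAlgebra.ι k b * shuffleRec h u + h (TensorAlgebra.ι k b * u) := by
  simp [shuffleRec]

lemma shuffleRec_add (h h' : TensorAlgebra k V →ₗ[k] TensorAlgebra k V) :
    shuffleRec (h + h') = shuffleRec h + shuffleRec h' := by
  refine LinearMap.ext fun t => ?_
  induction t using cons_induction with
  | one => simp
  | cons b t ht => simp only [LinearMap.add_apply] at ht; simp [ht, mul_add]; abel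
  | add x y hx hy => rw [map_add, map_add, hx, hy]
  | smul c x hx => rw [map_smul, map_smul, hx]

lemma shuffleRec_smul (c : k) (h : TensorAlgebra k V →ₗ[k] TensorAlgebra k V) :
    shuffleRec (c • h) = c • shuffleRec h := by
  refine LinearMap.ext fun t => ?_
  induction t using cons_induction with
  | one => simp
  | cons b t ht => simp only [LinearMap.smul_apply] at ht; simp [ht]
  | add x y hx hy => rw [map_add, map_add, hx, hy]
  | smul c x hx => rw [map_smul, map_smul, hx]

/-- The linear map `v ↦ (u ↦ u ⧢_σ v)`. With `f u = u ⧢_σ v'` known, the map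
`g u = u ⧢_σ (a ⊗ v')` is given by `g (b ⊗ u') = b ⊗ g u' + (id_V ⊗ f) β_{m,1}((b ⊗ u') ⊗ a)`. -/
def shuffleFlip (σ : V ⊗[k] V →ₗ[k] V ⊗[k] V) :
    TensorAlgebra k V →ₗ[k] TensorAlgebra k V →ₗ[k] TensorAlgebra k V :=
  fold LinearMap.id
    (LinearMap.mk₂ k (fun a f => shuffleRec (incl k V ∘ₗ f.lTensor V ∘ₗ letterBraid σ a))
      (by intros; simp [LinearMap.comp_add, shuffleRec_add])
      (by intros; simp [LinearMap.comp_smul, shuffleRec_smul])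
      (by intros; simp [LinearMap.comp_add, LinearMap.add_comp, LinearMap.lTensor_add,
            shuffleRec_add])
      (by intros; simp [LinearMap.comp_smul, LinearMap.smul_comp, LinearMap.lTensor_smul,
            shuffleRec_smul]))

/-- The quantum shuffle product `⧢_σ` on `T(V)`. -/
def shuffle (σ : V ⊗[k] V →ₗ[k] V ⊗[k] V) :
    TensorAlgebra k V →ₗ[k] TensorAlgebra k V →ₗ[k] TensorAlgebra k V :=
  (shuffleFlip σ).flip

/-- `shufflePast σ u ((a ⊗ v'))` is `(id_V ⊗ ⧢_σ)(β_{m,1}(u ⊗ a) ⊗ v')` for `u ∈ V^{⊗ m}`. -/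
def shufflePast (σ : V ⊗[k] V →ₗ[k] V ⊗[k] V) :
    TensorAlgebra k V →ₗ[k] TPlus k V →ₗ[k] TPlus k V :=
  (TensorProduct.lift (LinearMap.mk₂ k
    (fun a v => ((shuffle σ).flip v).lTensor V ∘ₗ letterBraid σ a)
    (by intros; simp [LinearMap.comp_add])
    (by intros; simp [LinearMap.comp_smul])
    (by intros; simp [LinearMap.add_comp, LinearMap.lTensor_add])
    (by intros; simp [LinearMap.smul_comp, LinearMap.lTensor_smul]))).flip

lemma shufflePast_tmul (σ : V ⊗[k] V →ₗ[k] V ⊗[k] V) (u : TensorAlgebra k V) (a : V)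
    (v : TensorAlgebra k V) : shufflePast σ u (a ⊗ₜ v) =
      ((shuffle σ).flip v).lTensor V (letterBraid σ a u) := by
  simp [shufflePast]

@[simp] lemma shuffle_one_right (σ : V ⊗[k] V →ₗ[k] V ⊗[k] V) (u : TensorAlgebra k V) :
    shuffle σ u 1 = u := by
  simp [shuffle, shuffleFlip]

/-- The recursion defining the quantum shuffle product. -/
lemma shuffle_cons_cons (σ : V ⊗[k] V →ₗ[k] V ⊗[k] V) (b : V) (u : TensorAlgebra k V) (a : V)
    (v : TensorAlgebra k V) :
    shuffle σ (TensorAlgebra.ι k b * u) (TensorAlgebra.ι k a * v) =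
      TensorAlgebra.ι k b * shuffle σ u (TensorAlgebra.ι k a * v)
      + incl k V (shufflePast σ (TensorAlgebra.ι k b * u) (a ⊗ₜ v)) := by
  have h : (shuffle σ).flip v = shuffleFlip σ v := by simp [shuffle]
  rw [shufflePast_tmul, h]
  simp [shuffle, shuffleFlip]

@[simp] lemma shuffle_one_left (σ : V ⊗[k] V →ₗ[k] V ⊗[k] V) (v : TensorAlgebra k V) :
    shuffle σ 1 v = v := by
  induction v using cons_induction with
  | one => simp
  | cons a t ht =>
    simp only [shuffle, LinearMap.flip_apply] at ht
    simp [shuffle, shuffleFlip] at ht ⊢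
    rw [ht]
  | add x y hx hy => simp [hx, hy]
  | smul c x hx => simp [hx]

/-- The half product `≺_σ` on `T⁺(V)`: `(b ⊗ u') ≺_σ v = b ⊗ (u' ⧢_σ v)`. -/
def prec (σ : V ⊗[k] V →ₗ[k] V ⊗[k] V) : TPlus k V ⊗[k] TPlus k V →ₗ[k] TPlus k V :=
  (TensorProduct.lift ((shuffle σ).compl₂ (incl k V))).lTensor V ∘ₗ
    (TensorProduct.assoc k V (TensorAlgebra k V) (TPlus k V)).toLinearMap

/-- The half product `≻_σ` on `T⁺(V)`:
`u ≻_σ (a ⊗ v') = (id_V ⊗ ⧢_σ)(β_{m,1}(u ⊗ a) ⊗ v')` for `u ∈ V^{⊗ m}`. -/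
def succ (σ : V ⊗[k] V →ₗ[k] V ⊗[k] V) : TPlus k V ⊗[k] TPlus k V →ₗ[k] TPlus k V :=
  TensorProduct.lift (shufflePast σ ∘ₗ incl k V)

lemma prec_tmul (σ : V ⊗[k] V →ₗ[k] V ⊗[k] V) (b : V) (u : TensorAlgebra k V)
    (v : TPlus k V) : prec σ ((b ⊗ₜ u) ⊗ₜ v) = b ⊗ₜ shuffle σ u (incl k V v) := by
  simp [prec]

lemma succ_tmul (σ : V ⊗[k] V →ₗ[k] V ⊗[k] V) (u : TPlus k V) (a : V)
    (v : TensorAlgebra k V) : succ σ (u ⊗ₜ (a ⊗ₜ v)) =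
      ((shuffle σ).flip v).lTensor V (letterBraid σ a (incl k V u)) := by
  simp [succ, shufflePast_tmul]

/-- The quantum shuffle product is the sum of its two halves. -/
lemma incl_prec_add_succ (σ : V ⊗[k] V →ₗ[k] V ⊗[k] V) (u v : TPlus k V) :
    incl k V ((prec σ + succ σ) (u ⊗ₜ v)) = shuffle σ (incl k V u) (incl k V v) := by
  induction u using TensorProduct.induction_on with
  | zero => simp
  | add x y hx hy => rw [TensorProduct.add_tmul, map_add, map_add, hx, hy]; simp
  | tmul b u =>
    induction v using TensorProduct.induction_on with
    | zero => simp
    | add x y hx hy => rw [TensorProduct.tmul_add, map_add, map_add, hx, hy]; simp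
    | tmul a v => simp [prec_tmul, succ, shuffle_cons_cons]

end QuantumShuffle

end BraidedDendriform

end

noncomputable section

namespace BraidedDendriform

universe u v w

/-! ## The algebra of the positive braid monoid on infinitely many strands -/

section BraidAlgebra

variable (k : Type u) [CommRing k]

/-! Every structure map on `T⁺(V)` is the action of a universal element of the algebra of positive
braids, followed by a choice of where to cut a tensor into factors. If an axiom, read on blocks of
fixed lengths, becomes an identity between such elements, it holds for every `σ` satisfying the
Yang-Baxter equation. No inverse of `σ` is needed, because only positive braids occur.

On blocks of lengths `m` and `n`, the braiding `β` is `block m n`, the quantum shuffle product is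
`shuf m n`, and its halves are `leftShuf m n` and `rightShuf m n`, according to the block that
supplies the front strand. The dictionary is `braidTPlus_cut`, `prec_cut`, `succ_cut` and
`star_cut`. It rests on `sigmaAt_braid` and `sigmaAt_comm`, which make the operators `sigmaAt σ i` a
representation, and on `cut_act` and `cut_act_sh`, which distribute braids over the factors of a
cut.

On the braid side, compatibility with `β` holds because a braid on one block slides through a block
transposition (`block_mul`, `block_mul_sh`, `block_add_left`, `block_add_right`). The dendriform
axioms are the three parts of `shuf_assoc`, sorted by the block that the front strand comes from.
The coproduct formulas come from `shuf_eq_sum` and its two halves: if the first `r` outgoing strands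
consist of `i` from the left block and `j` from the right one, a shuffle factors through the braid
separating these from the rest. Letting `(i, j)` run over the grid of possible values, the interior,
the edges and the corners give the separate terms of the formulas (`comul_mul_cut`). -/

/-- The braid relations among the generators indexed by `ℕ`. -/
inductive BraidRel : FreeAlgebra k ℕ → FreeAlgebra k ℕ → Prop
  | braid (i : ℕ) : BraidRel
      (FreeAlgebra.ι k i * FreeAlgebra.ι k (i + 1) * FreeAlgebra.ι k i)
      (FreeAlgebra.ι k (i + 1) * FreeAlgebra.ι k i * FreeAlgebra.ι k (i + 1))
  | comm (i j : ℕ) (h : i + 2 ≤ j) : BraidRel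
      (FreeAlgebra.ι k i * FreeAlgebra.ι k j) (FreeAlgebra.ι k j * FreeAlgebra.ι k i)

/-- The algebra over `k` generated by `s₀, s₁, …` subject to the braid relations. -/
abbrev BraidAlgebra : Type u := RingQuot (BraidRel k)

namespace BraidAlgebra

/-- The generator `sᵢ`. -/
def gen (i : ℕ) : BraidAlgebra k := RingQuot.mkAlgHom k (BraidRel k) (FreeAlgebra.ι k i)

lemma gen_braid (i : ℕ) :
    gen k i * gen k (i + 1) * gen k i = gen k (i + 1) * gen k i * gen k (i + 1) := by
  simpa [gen] using RingQuot.mkAlgHom_rel k (BraidRel.braid (k := k) i)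

lemma gen_comm {i j : ℕ} (h : i + 2 ≤ j) : gen k i * gen k j = gen k j * gen k i := by
  simpa [gen] using RingQuot.mkAlgHom_rel k (BraidRel.comm (k := k) i j h)

variable {k}

/-- The algebra map determined by elements satisfying the braid relations. -/
def lift {A : Type v} [Ring A] [Algebra k A] (s : ℕ → A)
    (hb : ∀ i, s i * s (i + 1) * s i = s (i + 1) * s i * s (i + 1))
    (hc : ∀ i j, i + 2 ≤ j → s i * s j = s j * s i) : BraidAlgebra k →ₐ[k] A :=
  RingQuot.liftAlgHom k ⟨FreeAlgebra.lift k s, by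
    rintro _ _ (i | ⟨i, j, h⟩)
    · simpa using hb i
    · simpa using hc i j h⟩

@[simp] lemma lift_gen {A : Type v} [Ring A] [Algebra k A] (s : ℕ → A)
    (hb : ∀ i, s i * s (i + 1) * s i = s (i + 1) * s i * s (i + 1))
    (hc : ∀ i j, i + 2 ≤ j → s i * s j = s j * s i) (i : ℕ) :
    lift s hb hc (gen k i) = s i := by
  simp [lift, gen]

@[elab_as_elim]
lemma induction {p : BraidAlgebra k → Prop} (algebraMap : ∀ r, p (algebraMap k _ r))
    (gen : ∀ i, p (gen k i)) (mul : ∀ x y, p x → p y → p (x * y))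
    (add : ∀ x y, p x → p y → p (x + y)) (x : BraidAlgebra k) : p x := by
  obtain ⟨x, rfl⟩ := RingQuot.mkAlgHom_surjective k (BraidRel k) x
  induction x using FreeAlgebra.induction with
  | grade0 r => simpa using algebraMap r
  | grade1 i => exact gen i
  | mul x y hx hy => simpa using mul _ _ hx hy
  | add x y hx hy => simpa using add _ _ hx hy

/-- The shift `sᵢ ↦ sᵢ₊ₙ`. -/
def sh (n : ℕ) : BraidAlgebra k →ₐ[k] BraidAlgebra k :=
  lift (fun i => gen k (i + n))
    (fun i => by simpa [add_right_comm] using gen_braid k (i + n))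
    (fun i j h => gen_comm k (by omega))

@[simp] lemma sh_gen (n i : ℕ) : sh n (gen k i) = gen k (i + n) := by simp [sh]

lemma sh_sh (m n : ℕ) (c : BraidAlgebra k) : sh m (sh n c) = sh (m + n) c := by
  induction c using BraidAlgebra.induction with
  | algebraMap r => simp
  | gen i => simp [add_assoc, add_comm n m]
  | mul x y hx hy => simp [hx, hy]
  | add x y hx hy => simp [hx, hy]

@[simp] lemma sh_zero (c : BraidAlgebra k) : sh 0 c = c := by
  induction c using BraidAlgebra.induction with
  | algebraMap r => simp
  | gen i => simp
  | mul x y hx hy => simp [hx, hy]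
  | add x y hx hy => simp [hx, hy]

variable (k) in
/-- The subalgebra of braids on the first `n` strands, generated by `sᵢ` with `i + 1 < n`. -/
def strands (n : ℕ) : Subalgebra k (BraidAlgebra k) :=
  Algebra.adjoin k (gen k '' {i | i + 1 < n})

lemma gen_mem {i n : ℕ} (h : i + 1 < n) : gen k i ∈ strands k n :=
  Algebra.subset_adjoin ⟨i, h, rfl⟩

lemma strands_mono {m n : ℕ} (h : m ≤ n) : strands k m ≤ strands k n :=
  Algebra.adjoin_mono (Set.image_mono fun _ hi => lt_of_lt_of_le hi h)

@[elab_as_elim]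
lemma strands_induction {n : ℕ} {p : ∀ x : BraidAlgebra k, x ∈ strands k n → Prop}
    (algebraMap : ∀ r, p (algebraMap k _ r) (Subalgebra.algebraMap_mem _ r))
    (gen : ∀ i (hi : i + 1 < n), p (gen k i) (gen_mem hi))
    (mul : ∀ x y hx hy, p x hx → p y hy → p (x * y) (Subalgebra.mul_mem _ hx hy))
    (add : ∀ x y hx hy, p x hx → p y hy → p (x + y) (Subalgebra.add_mem _ hx hy))
    {x : BraidAlgebra k} (hx : x ∈ strands k n) : p x hx := by
  induction hx using Algebra.adjoin_induction with
  | mem x hx => obtain ⟨i, hi, rfl⟩ := hx; exact gen i hi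
  | algebraMap r => exact algebraMap r
  | add x y _ _ hx hy => exact add x y _ _ hx hy
  | mul x y _ _ hx hy => exact mul x y _ _ hx hy

lemma sh_mem {m n p : ℕ} (h : m + n ≤ p) {c : BraidAlgebra k} (hc : c ∈ strands k n) :
    sh m c ∈ strands k p := by
  induction hc using strands_induction with
  | algebraMap r => simp
  | gen i hi => rw [sh_gen]; exact gen_mem (by omega)
  | mul x y _ _ hx hy => rw [map_mul]; exact Subalgebra.mul_mem _ hx hy
  | add x y _ _ hx hy => rw [map_add]; exact Subalgebra.add_mem _ hx hy

/-- If `x sᵢ = φ(sᵢ) x` for the generators on `n` strands, then `x c = φ(c) x` for all braids `c`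
on `n` strands. -/
lemma mul_eq_map_mul {n : ℕ} {x : BraidAlgebra k} {φ ψ : BraidAlgebra k →ₐ[k] BraidAlgebra k}
    (h : ∀ i, i + 1 < n → x * φ (gen k i) = ψ (gen k i) * x) {c : BraidAlgebra k}
    (hc : c ∈ strands k n) : x * φ c = ψ c * x := by
  induction hc using strands_induction with
  | algebraMap r => simp [Algebra.commutes]
  | gen i hi => exact h i hi
  | mul y z _ _ hy hz => rw [map_mul, map_mul, ← mul_assoc, hy, mul_assoc, hz, mul_assoc]
  | add y z _ _ hy hz => rw [map_add, map_add, mul_add, add_mul, hy, hz]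

/-- The two braids involve disjoint sets of strands, so each pair of generators has indices at least
two apart. -/
lemma strands_comm_sh {n : ℕ} {c : BraidAlgebra k} (hc : c ∈ strands k n) (d : BraidAlgebra k) :
    c * sh n d = sh n d * c := by
  have h : sh n d * AlgHom.id k _ c = AlgHom.id k _ c * sh n d := by
    refine mul_eq_map_mul (fun i hi => ?_) hc
    induction d using BraidAlgebra.induction with
    | algebraMap r => simp [Algebra.commutes]
    | gen j => simpa using (gen_comm k (by omega)).symm
    | mul y z hy hz =>
      rw [map_mul, mul_assoc, hz, ← mul_assoc, hy, mul_assoc]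
    | add y z hy hz => rw [map_add, add_mul, mul_add, hy, hz]
  exact h.symm

/-- Variant of `strands_comm_sh` with a larger shift. -/
lemma strands_comm_sh_of_le {m n : ℕ} (h : m ≤ n) {c : BraidAlgebra k} (hc : c ∈ strands k m)
    (d : BraidAlgebra k) : c * sh n d = sh n d * c :=
  strands_comm_sh (strands_mono h hc) d

/-! ### Moving one strand, or a block of strands, across another block. -/

variable (k) in
/-- The braid `s₀ s₁ ⋯ sₘ₋₁` moving one strand across `m` others. -/
def row (m : ℕ) : BraidAlgebra k := ((List.range m).map (gen k)).prod

@[simp] lemma row_zero : row k 0 = 1 := by simp [row]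

lemma sh_list (n : ℕ) (l : List ℕ) :
    sh n (l.map (gen k)).prod = ((l.map (· + n)).map (gen k)).prod := by
  induction l with
  | nil => simp
  | cons i l ih => simp [ih]

lemma row_add (m n : ℕ) : row k (m + n) = row k m * sh m (row k n) := by
  rw [row, row, row, sh_list, List.range_add, List.map_append, List.prod_append]
  simp only [add_comm]

lemma row_one : row k 1 = gen k 0 := by simp [row]

lemma row_succ (m : ℕ) : row k (m + 1) = row k m * gen k m := by
  rw [row_add, row_one, sh_gen, zero_add]

lemma row_mem (m : ℕ) : row k m ∈ strands k (m + 1) := by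
  induction m with
  | zero => simp
  | succ m ih =>
    rw [row_succ]
    exact Subalgebra.mul_mem _ (strands_mono (by omega) ih) (gen_mem (by omega))

/-- In `row k m` isolate the factor `sᵢ sᵢ₊₁`: the new `sᵢ` commutes with everything to the right of
it, the braid relation turns `sᵢ sᵢ₊₁ sᵢ` into `sᵢ₊₁ sᵢ sᵢ₊₁`, and `sᵢ₊₁` commutes with `row k i`.
-/
lemma row_mul_gen {m i : ℕ} (h : i + 1 < m) : row k m * gen k i = gen k (i + 1) * row k m := by
  obtain ⟨r, rfl⟩ := Nat.exists_eq_add_of_le (show i + 2 ≤ m by omega)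
  have h1 : sh (i + 2) (row k r) * gen k i = gen k i * sh (i + 2) (row k r) :=
    (strands_comm_sh (gen_mem (by omega)) _).symm
  have h2 : row k i * gen k (i + 1) = gen k (i + 1) * row k i := by
    simpa using strands_comm_sh (row_mem (k := k) i) (gen k 0)
  rw [row_add, mul_assoc, h1, row_succ, row_succ, ← mul_assoc, ← mul_assoc, ← mul_assoc,
    ← mul_assoc, ← h2]
  congr 1
  rw [mul_assoc, mul_assoc, mul_assoc, mul_assoc, ← mul_assoc (gen k i), gen_braid, mul_assoc]

/-- Products act from right to left: `row k m` brings the last of `m + 1` strands to the front, so a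
braid on the other `m` strands reappears one place further on. -/
lemma row_mul {m : ℕ} {c : BraidAlgebra k} (hc : c ∈ strands k m) :
    row k m * c = sh 1 c * row k m :=
  mul_eq_map_mul (φ := AlgHom.id k _) (fun i hi => by simpa using row_mul_gen hi) hc

variable (k) in
/-- The block transposition moving `n` strands across `m` others. -/
def block (m n : ℕ) : BraidAlgebra k := ((blockWord m n).map (gen k)).prod

@[simp] lemma block_zero_right (m : ℕ) : block k m 0 = 1 := by simp [block, blockWord]

lemma block_succ_right (m n : ℕ) : block k m (n + 1) = sh 1 (block k m n) * row k m := by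
  rw [block, blockWord, List.map_append, List.prod_append, block, sh_list, row]

@[simp] lemma block_zero_left (n : ℕ) : block k 0 n = 1 := by
  induction n with
  | zero => simp
  | succ n ih => simp [block_succ_right, ih]

lemma block_mem (m n : ℕ) : block k m n ∈ strands k (m + n) := by
  induction n with
  | zero => simp
  | succ n ih =>
    rw [block_succ_right]
    exact Subalgebra.mul_mem _ (sh_mem (by omega) ih) (strands_mono (by omega) (row_mem m))

lemma block_mul {m n : ℕ} {c : BraidAlgebra k} (hc : c ∈ strands k m) :
    block k m n * c = sh n c * block k m n := by
  induction n with
  | zero => simp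
  | succ n ih =>
    rw [block_succ_right, mul_assoc, row_mul hc, ← mul_assoc, ← map_mul, ih, map_mul, sh_sh,
      mul_assoc, add_comm 1 n]

/-- A crossing inside the right block slides through the transposition. Only a crossing of the first
two strands of that block needs an argument; any other commutes with the first row and is handled by
the shifted induction hypothesis. -/
lemma block_mul_gen {m n j : ℕ} (h : j + 1 < n) :
    block k m n * gen k (j + m) = gen k j * block k m n := by
  induction n generalizing j with
  | zero => omega
  | succ n ih =>
    rcases j with _ | j
    · obtain ⟨n, rfl⟩ : ∃ r, n = r + 1 := ⟨n - 1, by omega⟩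
      have h1 : gen k 0 * sh 2 (block k m n) = sh 2 (block k m n) * gen k 0 :=
        strands_comm_sh (gen_mem (by omega)) _
      -- Both sides equal `row k (m + 1) * row k m`: the left one by sliding `row k m` through the
      -- longer row, the right one by splitting off the first generator of that row.
      have h2 : sh 1 (row k m) * row k m * gen k m = gen k 0 * (sh 1 (row k m) * row k m) := by
        rw [mul_assoc, ← row_succ, ← row_mul (row_mem m), add_comm m 1, row_add, row_one,
          mul_assoc]
      rw [block_succ_right, block_succ_right, map_mul, sh_sh, zero_add, mul_assoc, mul_assoc,
        ← mul_assoc (sh 1 (row k m)), h2, mul_assoc (sh _ _), ← mul_assoc, ← h1, mul_assoc]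
    · have h1 : row k m * gen k (j + 1 + m) = gen k (j + 1 + m) * row k m := by
        simpa [add_assoc, add_comm m 1] using strands_comm_sh (row_mem (k := k) m) (gen k j)
      have h2 := congrArg (sh 1) (ih (j := j) (by omega))
      simp only [map_mul, sh_gen] at h2
      rw [block_succ_right, mul_assoc, h1, ← mul_assoc, add_right_comm, h2, mul_assoc]

lemma block_mul_sh {m n : ℕ} {c : BraidAlgebra k} (hc : c ∈ strands k n) :
    block k m n * sh m c = c * block k m n :=
  mul_eq_map_mul (φ := sh m) (ψ := AlgHom.id k _)
    (fun i hi => by simpa using block_mul_gen hi) hc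

lemma block_add_right (m n p : ℕ) :
    block k m (n + p) = sh n (block k m p) * block k m n := by
  induction n with
  | zero => simp
  | succ n ih =>
    rw [add_right_comm, block_succ_right, ih, map_mul, sh_sh, block_succ_right, mul_assoc,
      add_comm 1 n]

/-- Together with `block_add_right` this is the pair of hexagon identities. Each strand crosses the
two blocks in turn, and the crossings with the first block commute with those that later strands
make with the second. -/
lemma block_add_left (m n p : ℕ) :
    block k (m + n) p = block k m p * sh m (block k n p) := by
  induction p with
  | zero => simp
  | succ p ih =>
    have h := strands_comm_sh (row_mem (k := k) m) (block k n p)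
    rw [block_succ_right, block_succ_right, block_succ_right, ih, row_add, map_mul, map_mul,
      sh_sh, sh_sh, add_comm 1 m, mul_assoc, mul_assoc, ← mul_assoc (sh _ _) (row k m), ← h,
      mul_assoc]

/-- The Yang-Baxter equation for block transpositions. -/
lemma block_yang_baxter (m n p : ℕ) :
    block k n p * (sh n (block k m p) * block k m n) =
      sh p (block k m n) * (block k m p * sh m (block k n p)) := by
  -- Both sides contain the transposition of `m` strands with the joint block of `n + p`, and `block
  -- k n p` slides through it.
  rw [← block_add_right, ← mul_assoc, ← block_add_right, add_comm p n,
    block_mul_sh (block_mem n p)]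

/-! ### Sums of shuffle braids, their halves, and associativity. -/

variable (k) in
/-- The sum of the positive braids lifting the `(m, n)`-shuffles. -/
def shuf : ℕ → ℕ → BraidAlgebra k
  | 0, _ => 1
  | _ + 1, 0 => 1
  | m + 1, n + 1 => sh 1 (shuf m (n + 1)) + sh 1 (shuf (m + 1) n) * row k (m + 1)
  termination_by m n => m + n

@[simp] lemma shuf_zero_left (n : ℕ) : shuf k 0 n = 1 := by rw [shuf]

@[simp] lemma shuf_zero_right (m : ℕ) : shuf k m 0 = 1 := by
  cases m <;> rw [shuf]

lemma shuf_succ_succ (m n : ℕ) : shuf k (m + 1) (n + 1) =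
    sh 1 (shuf k m (n + 1)) + sh 1 (shuf k (m + 1) n) * row k (m + 1) := by
  rw [shuf]

lemma shuf_mem (m n : ℕ) : shuf k m n ∈ strands k (m + n) := by
  induction h : m + n generalizing m n with
  | zero =>
    obtain rfl : m = 0 := by omega
    simp
  | succ N ih =>
    rcases m with _ | m
    · simp
    rcases n with _ | n
    · simp
    rw [shuf_succ_succ]
    exact Subalgebra.add_mem _ (sh_mem (by omega) (ih _ _ (by omega)))
      (Subalgebra.mul_mem _ (sh_mem (by omega) (ih _ _ (by omega)))
        (strands_mono (by omega) (row_mem _)))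

variable (k) in
/-- The sum over the shuffles keeping the first strand of the left block in front. -/
def leftShuf : ℕ → ℕ → BraidAlgebra k
  | 0, _ => 0
  | m + 1, n => sh 1 (shuf k m n)

variable (k) in
/-- The sum over the shuffles moving the first strand of the right block to the front. -/
def rightShuf (m : ℕ) : ℕ → BraidAlgebra k
  | 0 => 0
  | n + 1 => sh 1 (shuf k m n) * row k m

@[simp] lemma leftShuf_zero_left (n : ℕ) : leftShuf k 0 n = 0 := rfl

@[simp] lemma rightShuf_zero_right (m : ℕ) : rightShuf k m 0 = 0 := rfl

lemma leftShuf_succ (m n : ℕ) : leftShuf k (m + 1) n = sh 1 (shuf k m n) := rfl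

lemma rightShuf_succ (m n : ℕ) : rightShuf k m (n + 1) = sh 1 (shuf k m n) * row k m := rfl

lemma leftShuf_zero_right {m : ℕ} (h : 1 ≤ m) : leftShuf k m 0 = 1 := by
  obtain ⟨m, rfl⟩ := Nat.exists_eq_add_of_le' h
  simp [leftShuf_succ]

lemma rightShuf_zero_left {n : ℕ} (h : 1 ≤ n) : rightShuf k 0 n = 1 := by
  obtain ⟨n, rfl⟩ := Nat.exists_eq_add_of_le' h
  simp [rightShuf_succ]

/-- The front strand comes from one of the two blocks. With no strands at all there is none: both
halves are then `0`, while `shuf k 0 0 = 1`. -/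
lemma shuf_eq_add {m n : ℕ} (h : 1 ≤ m + n) : shuf k m n = leftShuf k m n + rightShuf k m n := by
  rcases m with _ | m
  · simp [rightShuf_zero_left (k := k) (n := n) (by omega)]
  rcases n with _ | n
  · simp [leftShuf_succ]
  rw [shuf_succ_succ, leftShuf_succ, rightShuf_succ]

lemma leftShuf_mem (m n : ℕ) : leftShuf k m n ∈ strands k (m + n) := by
  rcases m with _ | m
  · simp
  · exact sh_mem (by omega) (shuf_mem m n)

lemma rightShuf_mem (m n : ℕ) : rightShuf k m n ∈ strands k (m + n) := by
  rcases n with _ | n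
  · simp
  · exact Subalgebra.mul_mem _ (sh_mem (by omega) (shuf_mem m n))
      (strands_mono (by omega) (row_mem m))

/-- This and the next two lemmas derive one dendriform identity each from associativity with one
strand fewer, by removing the front strand. The conditional form lets them drive the induction for
`shuf_assoc` and then yield the unconditional identities. -/
lemma leftShuf_mul_leftShuf_of {m n p : ℕ}
    (h : shuf k (m + n) p * shuf k m n = shuf k m (n + p) * sh m (shuf k n p)) :
    leftShuf k (m + 1 + n) p * leftShuf k (m + 1) n =
      leftShuf k (m + 1) (n + p) * sh (m + 1) (shuf k n p) := by
  rw [add_right_comm, leftShuf_succ, leftShuf_succ, leftShuf_succ, ← map_mul, h, map_mul, sh_sh,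
    add_comm 1 m]

lemma leftShuf_mul_rightShuf_of {m n p : ℕ}
    (h : shuf k (m + n) p * shuf k m n = shuf k m (n + p) * sh m (shuf k n p)) :
    leftShuf k (m + (n + 1)) p * rightShuf k m (n + 1) =
      rightShuf k m (n + 1 + p) * sh m (leftShuf k (n + 1) p) := by
  rw [← add_assoc, add_right_comm n 1 p, leftShuf_succ, leftShuf_succ, rightShuf_succ,
    rightShuf_succ, ← mul_assoc, ← map_mul, h, map_mul, sh_sh, sh_sh, mul_assoc, mul_assoc,
    strands_comm_sh (row_mem m), add_comm 1 m]

/-- The front strand comes from the third block. Its row slides past the shuffle of the first two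
blocks, then splits into a row across each of them, and the row across the first commutes with the
shuffle of the other two. -/
lemma rightShuf_mul_shuf_of {m n p : ℕ}
    (h : shuf k (m + n) p * shuf k m n = shuf k m (n + p) * sh m (shuf k n p)) :
    rightShuf k (m + n) (p + 1) * shuf k m n =
      rightShuf k m (n + (p + 1)) * sh m (rightShuf k n (p + 1)) := by
  rw [← add_assoc, rightShuf_succ, rightShuf_succ, rightShuf_succ, mul_assoc,
    row_mul (shuf_mem m n), ← mul_assoc, ← map_mul, h, map_mul, map_mul, sh_sh, sh_sh, row_add,
    mul_assoc, mul_assoc, ← mul_assoc (row k m), strands_comm_sh (row_mem m), add_comm 1 m,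
    mul_assoc]

/-- Associativity of shuffling. -/
lemma shuf_assoc (m n p : ℕ) :
    shuf k (m + n) p * shuf k m n = shuf k m (n + p) * sh m (shuf k n p) := by
  induction h : m + n + p generalizing m n p with
  | zero =>
    obtain rfl : m = 0 := by omega
    obtain rfl : n = 0 := by omega
    simp
  | succ N ih =>
    rcases m with _ | m
    · simp
    rcases n with _ | n
    · simp
    rcases p with _ | p
    · simp
    have h1 := leftShuf_mul_leftShuf_of (ih m (n + 1) (p + 1) (by omega))
    have h2 := leftShuf_mul_rightShuf_of (ih (m + 1) n (p + 1) (by omega))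
    have h3 := rightShuf_mul_shuf_of (ih (m + 1) (n + 1) p (by omega))
    -- Both sides split into three parts according to the block supplying the front strand: `h1`,
    -- `h2` and `h3` match the first, second and third block.
    rw [shuf_eq_add (k := k) (m := m + 1 + (n + 1)) (by omega), add_mul, h3,
      shuf_eq_add (k := k) (m := m + 1) (n := n + 1) (by omega), mul_add, h1, h2,
      shuf_eq_add (k := k) (m := m + 1) (n := n + 1 + (p + 1)) (by omega),
      shuf_eq_add (k := k) (m := n + 1) (n := p + 1) (by omega), map_add]
    noncomm_ring

lemma leftShuf_mul_leftShuf {m : ℕ} (hm : 1 ≤ m) (n p : ℕ) :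
    leftShuf k (m + n) p * leftShuf k m n = leftShuf k m (n + p) * sh m (shuf k n p) := by
  obtain ⟨m, rfl⟩ := Nat.exists_eq_add_of_le' hm
  exact leftShuf_mul_leftShuf_of (shuf_assoc m n p)

lemma leftShuf_mul_rightShuf (m : ℕ) {n : ℕ} (hn : 1 ≤ n) (p : ℕ) :
    leftShuf k (m + n) p * rightShuf k m n = rightShuf k m (n + p) * sh m (leftShuf k n p) := by
  obtain ⟨n, rfl⟩ := Nat.exists_eq_add_of_le' hn
  exact leftShuf_mul_rightShuf_of (shuf_assoc m n p)

lemma rightShuf_mul_shuf (m n : ℕ) {p : ℕ} (hp : 1 ≤ p) :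
    rightShuf k (m + n) p * shuf k m n = rightShuf k m (n + p) * sh m (rightShuf k n p) := by
  obtain ⟨p, rfl⟩ := Nat.exists_eq_add_of_le' hp
  exact rightShuf_mul_shuf_of (shuf_assoc m n p)

/-! ### Factoring shuffles through their first strands. -/

variable (k) in
/-- The braids that separate `m + n` strands into the first `i` of the left block together with
the first `j` of the right block, and the rest, which is then shuffled. -/
def shufRest (m n i j : ℕ) : BraidAlgebra k :=
  sh (i + j) (shuf k (m - i) (n - j)) * sh i (block k (m - i) j)

lemma shufRest_succ_left (m n i j : ℕ) :
    sh 1 (shufRest k m n i j) = shufRest k (m + 1) n (i + 1) j := by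
  simp only [shufRest, map_mul, sh_sh, Nat.add_sub_add_right]
  rw [add_right_comm, add_comm 1 (i + j), add_comm 1 i]

/-- The strand crossing all `m` left strands crosses the last `m - i` of them and then the first
`i`. The former crossings enlarge the transposition inside `shufRest` from `j` to `j + 1` strands;
the latter commute with the rest and come out in front. -/
lemma shufRest_succ_right {m i : ℕ} (h : i ≤ m) (n j : ℕ) :
    sh 1 (shufRest k m n i j) * row k m = row k i * shufRest k m (n + 1) i (j + 1) := by
  obtain ⟨m, rfl⟩ := Nat.exists_eq_add_of_le h
  simp only [shufRest, map_mul, sh_sh, Nat.add_sub_add_right, Nat.add_sub_cancel_left]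
  have h1 := strands_comm_sh_of_le (n := i + (j + 1)) (by omega) (row_mem (k := k) i)
    (shuf k m (n - j))
  have h2 := strands_comm_sh (row_mem (k := k) i) (block k m j)
  rw [block_succ_right, map_mul, sh_sh, row_add, add_comm 1 i, add_comm 1 (i + j), add_assoc i j 1,
    mul_assoc, ← mul_assoc _ (row k i), ← h2, mul_assoc, ← mul_assoc, ← h1, mul_assoc]

/-- The decomposition of shuffles according to their first `r` strands. -/
lemma leftShuf_eq_sum_of {m n r : ℕ}
    (h : shuf k m n = ∑ i ∈ Finset.range (m + 1), ∑ j ∈ Finset.range (n + 1),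
      if i + j = r then shuf k i j * shufRest k m n i j else 0) :
    leftShuf k (m + 1) n = ∑ i ∈ Finset.range (m + 2), ∑ j ∈ Finset.range (n + 1),
      if i + j = r + 1 then leftShuf k i j * shufRest k (m + 1) n i j else 0 := by
  -- The separated summand `i = 0` vanishes because `leftShuf k 0 j = 0`; the others are reindexed
  -- by `i + 1`.
  rw [leftShuf_succ, h, map_sum, Finset.sum_range_succ' _ (m + 1)]
  simp only [leftShuf_zero_left, zero_mul, ite_self, Finset.sum_const_zero, add_zero, map_sum]
  refine Finset.sum_congr rfl fun i _ => Finset.sum_congr rfl fun j _ => ?_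
  rw [apply_ite (sh 1), map_mul, map_zero, shufRest_succ_left, leftShuf_succ]
  exact if_congr (by omega) rfl rfl

lemma rightShuf_eq_sum_of {m n r : ℕ}
    (h : shuf k m n = ∑ i ∈ Finset.range (m + 1), ∑ j ∈ Finset.range (n + 1),
      if i + j = r then shuf k i j * shufRest k m n i j else 0) :
    rightShuf k m (n + 1) = ∑ i ∈ Finset.range (m + 1), ∑ j ∈ Finset.range (n + 2),
      if i + j = r + 1 then rightShuf k i j * shufRest k m (n + 1) i j else 0 := by
  rw [rightShuf_succ, h, map_sum, Finset.sum_mul]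
  refine Finset.sum_congr rfl fun i hi => ?_
  rw [Finset.sum_range_succ' _ (n + 1)]
  simp only [rightShuf_zero_right, zero_mul, ite_self, add_zero, map_sum, Finset.sum_mul]
  refine Finset.sum_congr rfl fun j _ => ?_
  rw [apply_ite (sh 1), map_mul, map_zero, ite_mul, zero_mul, mul_assoc,
    shufRest_succ_right (by simpa [Nat.lt_succ_iff] using hi), ← mul_assoc, rightShuf_succ]
  exact if_congr (by omega) rfl rfl

/-- The braid form of the compatibility of shuffling with deconcatenation. The induction on `r`
removes the front strand, separately for the two halves. -/
lemma shuf_eq_sum {m n r : ℕ} (hr : r ≤ m + n) :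
    shuf k m n = ∑ i ∈ Finset.range (m + 1), ∑ j ∈ Finset.range (n + 1),
      if i + j = r then shuf k i j * shufRest k m n i j else 0 := by
  induction r generalizing m n with
  | zero =>
    -- For `r = 0` only `i = j = 0` contributes, and `shufRest k m n 0 0` is the whole shuffle.
    rw [Finset.sum_range_succ', Finset.sum_range_succ']
    simp [shufRest]
  | succ r ih =>
    have hl : leftShuf k m n = ∑ i ∈ Finset.range (m + 1), ∑ j ∈ Finset.range (n + 1),
        if i + j = r + 1 then leftShuf k i j * shufRest k m n i j else 0 := by
      rcases m with _ | m
      · simp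
      · exact leftShuf_eq_sum_of (ih (by omega))
    have hr : rightShuf k m n = ∑ i ∈ Finset.range (m + 1), ∑ j ∈ Finset.range (n + 1),
        if i + j = r + 1 then rightShuf k i j * shufRest k m n i j else 0 := by
      rcases n with _ | n
      · simp
      · exact rightShuf_eq_sum_of (ih (by omega))
    rw [shuf_eq_add (by omega), hl, hr, ← Finset.sum_add_distrib]
    refine Finset.sum_congr rfl fun i _ => ?_
    rw [← Finset.sum_add_distrib]
    refine Finset.sum_congr rfl fun j _ => ?_
    split_ifs with h
    · rw [shuf_eq_add (k := k) (m := i) (by omega), add_mul]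
    · simp

/-- The value `r = 0` has to be excluded: its only term contains `leftShuf k 0 0 = 0`. -/
lemma leftShuf_eq_sum {m n r : ℕ} (h1 : 1 ≤ r) (hr : r ≤ m + n) :
    leftShuf k m n = ∑ i ∈ Finset.range (m + 1), ∑ j ∈ Finset.range (n + 1),
      if i + j = r then leftShuf k i j * shufRest k m n i j else 0 := by
  obtain ⟨r, rfl⟩ := Nat.exists_eq_add_of_le' h1
  rcases m with _ | m
  · simp
  · exact leftShuf_eq_sum_of (shuf_eq_sum (by omega))

lemma rightShuf_eq_sum {m n r : ℕ} (h1 : 1 ≤ r) (hr : r ≤ m + n) :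
    rightShuf k m n = ∑ i ∈ Finset.range (m + 1), ∑ j ∈ Finset.range (n + 1),
      if i + j = r then rightShuf k i j * shufRest k m n i j else 0 := by
  obtain ⟨r, rfl⟩ := Nat.exists_eq_add_of_le' h1
  rcases n with _ | n
  · simp
  · exact rightShuf_eq_sum_of (shuf_eq_sum (by omega))

end BraidAlgebra

end BraidAlgebra

section Words

variable {k : Type u} [CommRing k] {V : Type v} [AddCommGroup V] [Module k V]
variable {M : Type*} [AddCommGroup M] [Module k M] {M' : Type*} [AddCommGroup M'] [Module k M']
variable {N : Type*} [AddCommGroup N] [Module k N] {N' : Type*} [AddCommGroup N'] [Module k N']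

/-! ## Homogeneous tensors -/

variable (k V) in
/-- The subspace `V^{⊗ n}` of `T(V)`. -/
def homog (n : ℕ) : Submodule k (TensorAlgebra k V) :=
  Submodule.span k (word k '' {l : List V | l.length = n})

lemma word_mem (l : List V) : word k l ∈ homog k V l.length :=
  Submodule.subset_span ⟨l, rfl, rfl⟩

lemma eq_on_homog {F G : TensorAlgebra k V →ₗ[k] M} {n : ℕ}
    (h : ∀ l : List V, l.length = n → F (word k l) = G (word k l)) {t : TensorAlgebra k V}
    (ht : t ∈ homog k V n) : F t = G t := by
  refine LinearMap.eqOn_span (f := F) (g := G) ?_ ht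
  rintro _ ⟨l, hl, rfl⟩
  exact h l hl

lemma eq_on_homog_add {F G : TensorAlgebra k V →ₗ[k] M} {m n : ℕ}
    (h : ∀ l l' : List V, l.length = m → l'.length = n →
      F (word k l * word k l') = G (word k l * word k l')) {t : TensorAlgebra k V}
    (ht : t ∈ homog k V (m + n)) : F t = G t := by
  refine eq_on_homog (fun l hl => ?_) ht
  rw [← List.take_append_drop m l, word_append]
  exact h _ _ (by simp [hl]) (by simp [hl])

lemma map_homog_le {F : TensorAlgebra k V →ₗ[k] M} {n : ℕ} {S : Submodule k M}
    (h : ∀ l : List V, l.length = n → F (word k l) ∈ S) {t : TensorAlgebra k V}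
    (ht : t ∈ homog k V n) : F t ∈ S := by
  have : homog k V n ≤ S.comap F := by
    rw [homog, Submodule.span_le]
    rintro _ ⟨l, hl, rfl⟩
    exact h l hl
  exact this ht

lemma cons_mem (a : V) {n : ℕ} {t : TensorAlgebra k V} (ht : t ∈ homog k V n) :
    TensorAlgebra.ι k a * t ∈ homog k V (n + 1) := by
  refine map_homog_le (F := LinearMap.mul k _ (TensorAlgebra.ι k a)) (fun l hl => ?_) ht
  subst hl
  simpa using word_mem (k := k) (a :: l)

lemma word_induction {p : TensorAlgebra k V → Prop} (word : ∀ l, p (word k l))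
    (add : ∀ s t, p s → p t → p (s + t)) (smul : ∀ (c : k) t, p t → p (c • t))
    (t : TensorAlgebra k V) : p t := by
  -- `p` is not assumed stable under adding a letter in front, so the claim carries a prefix, which
  -- absorbs the letters removed from `t`.
  have key : ∀ l, p (BraidedDendriform.word k l * t) := by
    induction t using cons_induction with
    | one => simpa using word
    | cons a t ht => exact fun l => by simpa [word_append, mul_assoc] using ht (l ++ [a])
    | add s t hs ht => exact fun l => by rw [mul_add]; exact add _ _ (hs l) (ht l)
    | smul c t ht => exact fun l => by rw [mul_smul_comm]; exact smul _ _ (ht l)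
  simpa using key []

lemma incl_proj_word {l : List V} (h : 1 ≤ l.length) :
    incl k V (proj k V (word k l)) = word k l := by
  rcases l with _ | ⟨a, l⟩
  · simp at h
  · simp

lemma TPlus.hom_ext {F G : TPlus k V →ₗ[k] M}
    (h : ∀ l : List V, 1 ≤ l.length → F (proj k V (word k l)) = G (proj k V (word k l))) :
    F = G := by
  refine LinearMap.ext fun x => ?_
  rw [← proj_incl x]
  induction incl k V x using word_induction with
  | word l =>
    rcases l with _ | ⟨a, l⟩
    · simp
    · exact h _ (by simp)
  | add s t hs ht => simp only [map_add, hs, ht]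
  | smul c t ht => simp only [map_smul, ht]

/-- The braided tensor is in general not pure, but it is a combination of pure tensors with words of
the same length. This lets induction hypotheses about words apply to it. -/
lemma letterBraid_ext {F G : TPlus k V →ₗ[k] M} (σ : V ⊗[k] V →ₗ[k] V ⊗[k] V) (a : V)
    (l : List V)
    (h : ∀ (b : V) (l' : List V), l'.length = l.length →
      F (b ⊗ₜ word k l') = G (b ⊗ₜ word k l')) :
    F (letterBraid σ a (word k l)) = G (letterBraid σ a (word k l)) := by
  refine LinearMap.eqOn_span (f := F) (g := G) ?_ (letterBraid_mem σ a l)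
  rintro _ ⟨b, l', hl, rfl⟩
  exact h b l' hl

/-! ## Cutting tensors -/

variable (k V) in
/-- The map `v₁ ⋯ vₙ ↦ (v₁ ⋯ vₚ) ⊗ (vₚ₊₁ ⋯ vₙ)`, zero for `n < p`. -/
def split : ℕ → TensorAlgebra k V →ₗ[k] TensorAlgebra k V ⊗[k] TensorAlgebra k V
  | 0 => TensorProduct.mk k _ _ 1
  | p + 1 => (incl k V).rTensor (TensorAlgebra k V) ∘ₗ
      (TensorProduct.assoc k V (TensorAlgebra k V) (TensorAlgebra k V)).symm.toLinearMap ∘ₗ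
      (split p).lTensor V ∘ₗ proj k V

/-- `(f ⊗ g)` applied to the first `p` letters and to the remaining ones. -/
def cut (p : ℕ) (f : TensorAlgebra k V →ₗ[k] M) (g : TensorAlgebra k V →ₗ[k] N) :
    TensorAlgebra k V →ₗ[k] M ⊗[k] N :=
  TensorProduct.map f g ∘ₗ split k V p

@[simp] lemma split_zero (t : TensorAlgebra k V) : split k V 0 t = 1 ⊗ₜ t := rfl

@[simp] lemma split_succ_one (p : ℕ) : split k V (p + 1) 1 = 0 := by simp [split]

lemma split_succ_cons (p : ℕ) (a : V) (t : TensorAlgebra k V) :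
    split k V (p + 1) (TensorAlgebra.ι k a * t) =
      (LinearMap.mul k _ (TensorAlgebra.ι k a)).rTensor _ (split k V p t) := by
  simp only [split, LinearMap.comp_apply, proj_cons, LinearMap.lTensor_tmul, LinearEquiv.coe_coe]
  induction split k V p t using TensorProduct.induction_on with
  | zero => simp
  | tmul x y => simp
  | add x y hx hy => simp only [TensorProduct.tmul_add, map_add, hx, hy]

section Cut

variable (p : ℕ) (f : TensorAlgebra k V →ₗ[k] M) (g : TensorAlgebra k V →ₗ[k] N)

lemma cut_zero (t : TensorAlgebra k V) : cut 0 f g t = f 1 ⊗ₜ g t := by simp [cut]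

lemma cut_succ_one : cut (p + 1) f g 1 = 0 := by simp [cut]

lemma cut_succ_cons (a : V) (t : TensorAlgebra k V) :
    cut (p + 1) f g (TensorAlgebra.ι k a * t) =
      cut p (f ∘ₗ LinearMap.mul k _ (TensorAlgebra.ι k a)) g t := by
  rw [cut, LinearMap.comp_apply, split_succ_cons, ← LinearMap.comp_apply (TensorProduct.map f g),
    LinearMap.map_comp_rTensor]
  rfl

lemma map_cut (F : M →ₗ[k] M') (G : N →ₗ[k] N') (t : TensorAlgebra k V) :
    TensorProduct.map F G (cut p f g t) = cut p (F ∘ₗ f) (G ∘ₗ g) t := by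
  rw [cut, cut, TensorProduct.map_comp]
  rfl

lemma lTensor_cut (G : N →ₗ[k] N') (t : TensorAlgebra k V) :
    G.lTensor M (cut p f g t) = cut p f (G ∘ₗ g) t :=
  map_cut p f g LinearMap.id G t

lemma rTensor_cut (F : M →ₗ[k] M') (t : TensorAlgebra k V) :
    F.rTensor N (cut p f g t) = cut p (F ∘ₗ f) g t :=
  map_cut p f g F LinearMap.id t

lemma cut_word {l : List V} (h : l.length = p) (t : TensorAlgebra k V) :
    cut p f g (word k l * t) = f (word k l) ⊗ₜ g t := by
  induction l generalizing p f with
  | nil => subst h; simp [cut_zero]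
  | cons a l ih =>
    subst h
    rw [word_cons, mul_assoc, List.length_cons, cut_succ_cons, ih _ _ rfl]
    rfl

lemma assoc_cut {q : ℕ} (h : TensorAlgebra k V →ₗ[k] M') (t : TensorAlgebra k V) :
    TensorProduct.assoc k M N M' (cut (p + q) (cut p f g) h t) = cut p f (cut q g h) t := by
  induction p generalizing f t with
  | zero =>
    have : cut 0 f g = TensorProduct.mk k M N (f 1) ∘ₗ g := by ext t; simp [cut_zero]
    rw [this, zero_add, cut_zero, ← LinearMap.id_comp h, ← map_cut, LinearMap.id_comp]
    induction cut q g h t using TensorProduct.induction_on with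
    | zero => simp
    | tmul x y => simp
    | add x y hx hy => simp only [TensorProduct.tmul_add, map_add, hx, hy]
  | succ p ih =>
    rw [add_right_comm]
    induction t using cons_induction with
    | one => simp [cut_succ_one]
    | cons a t _ =>
      rw [cut_succ_cons, cut_succ_cons, ← ih]
      congr 3
      exact LinearMap.ext fun t => cut_succ_cons _ _ _ _ _
    | add s t hs ht => simp only [map_add, hs, ht]
    | smul c t ht => simp only [map_smul, ht]

lemma assoc_symm_cut {q : ℕ} (h : TensorAlgebra k V →ₗ[k] M') (t : TensorAlgebra k V) :
    (TensorProduct.assoc k M N M').symm (cut p f (cut q g h) t) =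
      cut (p + q) (cut p f g) h t := by
  rw [← assoc_cut, LinearEquiv.symm_apply_apply]

variable {p f g} in
-- The degree of `t` fixes the degrees of both factors, so formulas valid in a single degree may be
-- inserted into a cut.
lemma cut_congr {q : ℕ} {f' : TensorAlgebra k V →ₗ[k] M} {g' : TensorAlgebra k V →ₗ[k] N}
    {t : TensorAlgebra k V} (ht : t ∈ homog k V (p + q))
    (hf : ∀ x ∈ homog k V p, f x = f' x) (hg : ∀ x ∈ homog k V q, g x = g' x) :
    cut p f g t = cut p f' g' t := by
  refine eq_on_homog_add (fun l l' hl hl' => ?_) ht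
  subst hl hl'
  rw [cut_word _ _ _ rfl, cut_word _ _ _ rfl, hf _ (word_mem l), hg _ (word_mem l')]

lemma cut_sum_left {ι : Type*} (s : Finset ι) (F : ι → TensorAlgebra k V →ₗ[k] M)
    (t : TensorAlgebra k V) : cut p (∑ i ∈ s, F i) g t = ∑ i ∈ s, cut p (F i) g t := by
  simp only [cut, LinearMap.comp_apply]
  rw [← TensorProduct.mapBilinear_apply, map_sum, LinearMap.sum_apply, LinearMap.sum_apply]
  rfl

lemma cut_sum_right {ι : Type*} (s : Finset ι) (G : ι → TensorAlgebra k V →ₗ[k] N)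
    (t : TensorAlgebra k V) : cut p f (∑ i ∈ s, G i) t = ∑ i ∈ s, cut p f (G i) t := by
  simp only [cut, LinearMap.comp_apply]
  rw [← TensorProduct.mapBilinear_apply, map_sum, LinearMap.sum_apply]
  rfl

end Cut

/-- A tensor of two words is a cut of their concatenation. Testing on all homogeneous `t`, and not
just on words, fits the braid action, which does not preserve words. -/
lemma TPlus.hom_ext₂ {F G : TPlus k V ⊗[k] TPlus k V →ₗ[k] M}
    (h : ∀ m n : ℕ, 1 ≤ m → 1 ≤ n → ∀ t ∈ homog k V (m + n),
      F (cut m (proj k V) (proj k V) t) = G (cut m (proj k V) (proj k V) t)) : F = G := by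
  refine TensorProduct.ext (TPlus.hom_ext fun l hl => TPlus.hom_ext fun l' hl' => ?_)
  have := h _ _ hl hl' (word k (l ++ l')) (by simpa using word_mem (k := k) (l ++ l'))
  rw [word_append, cut_word _ _ _ rfl] at this
  exact this

lemma TPlus.hom_ext₃ {F G : TPlus k V ⊗[k] (TPlus k V ⊗[k] TPlus k V) →ₗ[k] M}
    (h : ∀ m n p : ℕ, 1 ≤ m → 1 ≤ n → 1 ≤ p → ∀ t ∈ homog k V (m + n + p),
      F (cut m (proj k V) (cut n (proj k V) (proj k V)) t) =
        G (cut m (proj k V) (cut n (proj k V) (proj k V)) t)) : F = G := by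
  refine TensorProduct.ext (TPlus.hom_ext fun l hl => TensorProduct.ext
    (TPlus.hom_ext fun l' hl' => TPlus.hom_ext fun l'' hl'' => ?_))
  have := h _ _ _ hl hl' hl'' (word k (l ++ (l' ++ l'')))
    (by simpa [add_assoc] using word_mem (k := k) (l ++ (l' ++ l'')))
  rw [word_append, cut_word _ _ _ rfl, word_append, cut_word _ _ _ rfl] at this
  exact this

/-- The reduced coproduct in terms of cuts. -/
lemma reducedDeconcat_proj {n : ℕ} {t : TensorAlgebra k V} (ht : t ∈ homog k V n) :
    reducedDeconcat k V (proj k V t) =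
      ∑ r ∈ Finset.Ico 1 n, cut r (proj k V) (proj k V) t := by
  have key : ∀ l : List V, l.length = n → (reducedDeconcat k V ∘ₗ proj k V) (word k l) =
      (∑ r ∈ Finset.Ico 1 n, cut r (proj k V) (proj k V)) (word k l) := by
    rintro l rfl
    rw [LinearMap.sum_apply, LinearMap.comp_apply]
    rcases l with _ | ⟨a, l⟩
    · simp
    -- The first and last terms of the deconcatenation have a factor `1`, which `proj` kills.
    rw [reducedDeconcat, LinearMap.comp_apply, LinearMap.comp_apply,
      incl_proj_word (by simp), deconcat_word, map_sum, Finset.sum_range_succ,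
      Finset.range_eq_Ico, Finset.sum_eq_sum_Ico_succ_bot (by simp)]
    simp only [List.take_zero, List.drop_length, word_nil, TensorProduct.map_tmul, proj_one,
      TensorProduct.zero_tmul, TensorProduct.tmul_zero, zero_add, add_zero]
    refine Finset.sum_congr rfl fun i hi => ?_
    rw [Finset.mem_Ico] at hi
    conv_rhs => rw [← List.take_append_drop i (a :: l), word_append]
    rw [cut_word _ _ _ (by simp at hi ⊢; omega)]
  simpa using eq_on_homog key ht

end Words

/-! ## The action of braids on tensors -/

section Action

variable {k : Type u} [CommRing k] {V : Type v} [AddCommGroup V] [Module k V]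
variable {M : Type*} [AddCommGroup M] [Module k M] {N : Type*} [AddCommGroup N] [Module k N]
variable (σ : V ⊗[k] V →ₗ[k] V ⊗[k] V)

open BraidAlgebra

@[simp] lemma sigmaAt_one (i : ℕ) : sigmaAt σ i 1 = 0 := by
  cases i <;> simp [sigmaAt]

lemma sigmaAt_zero_cons_one (a : V) : sigmaAt σ 0 (TensorAlgebra.ι k a * 1) = 0 := by
  simp only [sigmaAt, LinearMap.comp_apply, proj_cons, LinearMap.lTensor_tmul, proj_one,
    TensorProduct.tmul_zero, map_zero]

variable (k V) in
/-- The map `x ⊗ y ↦ (t ↦ x ⊗ y ⊗ t)`. -/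
def glue : V ⊗[k] V →ₗ[k] TensorAlgebra k V →ₗ[k] TensorAlgebra k V :=
  LinearMap.mul k _ ∘ₗ LinearMap.mul' k _ ∘ₗ
    TensorProduct.map (TensorAlgebra.ι k) (TensorAlgebra.ι k)

@[simp] lemma glue_tmul (t : TensorAlgebra k V) (x y : V) :
    glue k V (x ⊗ₜ y) t = TensorAlgebra.ι k x * (TensorAlgebra.ι k y * t) := by
  simp [glue, mul_assoc]

lemma sigmaAt_zero_cons_cons (a b : V) (t : TensorAlgebra k V) :
    sigmaAt σ 0 (TensorAlgebra.ι k a * (TensorAlgebra.ι k b * t)) = glue k V (σ (a ⊗ₜ b)) t := by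
  simp only [sigmaAt, LinearMap.comp_apply, proj_cons, LinearMap.lTensor_tmul, braidFirst,
    LinearEquiv.coe_coe, TensorProduct.assoc_symm_tmul, LinearMap.rTensor_tmul]
  induction σ (a ⊗ₜ b) using TensorProduct.induction_on with
  | zero => simp
  | add x y hx hy => simp only [TensorProduct.add_tmul, map_add, LinearMap.add_apply, hx, hy]
  | tmul x y => simp

lemma sigmaAt_zero_glue (t : TensorAlgebra k V) (x : V ⊗[k] V) :
    sigmaAt σ 0 (glue k V x t) = glue k V (σ x) t := by
  induction x using TensorProduct.induction_on with
  | zero => simp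
  | add x y hx hy => simp only [map_add, LinearMap.add_apply, hx, hy]
  | tmul x y => rw [glue_tmul, sigmaAt_zero_cons_cons]

lemma sigmaAt_glue (i : ℕ) (t : TensorAlgebra k V) (x : V ⊗[k] V) :
    sigmaAt σ (i + 2) (glue k V x t) = glue k V x (sigmaAt σ i t) := by
  induction x using TensorProduct.induction_on with
  | zero => simp
  | add x y hx hy => simp only [map_add, LinearMap.add_apply, hx, hy]
  | tmul x y => rw [glue_tmul, sigmaAt_succ_cons, sigmaAt_succ_cons, glue_tmul]

/-- The map `x ⊗ y ⊗ z ↦ x ⊗ y ⊗ z ⊗ t`. -/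
def glue₃ (t : TensorAlgebra k V) : V ⊗[k] (V ⊗[k] V) →ₗ[k] TensorAlgebra k V :=
  LinearMap.mul' k _ ∘ₗ TensorProduct.map (TensorAlgebra.ι k) ((glue k V).flip t)

@[simp] lemma glue₃_tmul (t : TensorAlgebra k V) (x : V) (y : V ⊗[k] V) :
    glue₃ t (x ⊗ₜ y) = TensorAlgebra.ι k x * glue k V y t := by
  simp [glue₃]

lemma glue₃_assoc (t : TensorAlgebra k V) (x : V ⊗[k] V) (z : V) :
    glue₃ t (TensorProduct.assoc k V V V (x ⊗ₜ z)) = glue k V x (TensorAlgebra.ι k z * t) := by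
  induction x using TensorProduct.induction_on with
  | zero => simp
  | add x y hx hy => simp only [TensorProduct.add_tmul, map_add, LinearMap.add_apply, hx, hy]
  | tmul x y => simp

lemma sigmaAt_zero_glue₃ (t : TensorAlgebra k V) (x : V ⊗[k] (V ⊗[k] V)) :
    sigmaAt σ 0 (glue₃ t x) = glue₃ t (braid₁ σ x) := by
  have h : sigmaAt σ 0 ∘ₗ glue₃ t = glue₃ t ∘ₗ braid₁ σ := by
    refine TensorProduct.ext' fun x y => ?_
    induction y using TensorProduct.induction_on with
    | zero => simp
    | add y z hy hz => simp only [TensorProduct.tmul_add, map_add, hy, hz]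
    | tmul y z =>
      simp [braid₁, braidFirst, glue₃_assoc, sigmaAt_zero_cons_cons]
  exact LinearMap.congr_fun h x

lemma sigmaAt_one_glue₃ (t : TensorAlgebra k V) (x : V ⊗[k] (V ⊗[k] V)) :
    sigmaAt σ 1 (glue₃ t x) = glue₃ t (braid₂ σ x) := by
  have h : sigmaAt σ 1 ∘ₗ glue₃ t = glue₃ t ∘ₗ braid₂ σ := by
    refine TensorProduct.ext' fun x y => ?_
    simp [braid₂, sigmaAt_succ_cons _ 0, sigmaAt_zero_glue]
  exact LinearMap.congr_fun h x

lemma sigmaAt_one_glue_one (x : V ⊗[k] V) : sigmaAt σ 1 (glue k V x 1) = 0 := by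
  induction x using TensorProduct.induction_on with
  | zero => simp
  | add x y hx hy => simp only [map_add, LinearMap.add_apply, hx, hy, add_zero]
  | tmul x y => rw [glue_tmul, sigmaAt_succ_cons _ 0, sigmaAt_zero_cons_one, mul_zero]

variable {σ} in
-- Letters in front of the crossings are stripped until `i = 0`; then the relation is the
-- Yang-Baxter equation on the first three letters.
lemma sigmaAt_braid (hσ : IsBraiding σ) (i : ℕ) :
    sigmaAt σ i * sigmaAt σ (i + 1) * sigmaAt σ i =
      sigmaAt σ (i + 1) * sigmaAt σ i * sigmaAt σ (i + 1) := by
  refine LinearMap.ext fun t => ?_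
  simp only [Module.End.mul_apply]
  induction i generalizing t with
  | zero =>
    induction t using word_induction with
    | add s t hs ht => simp only [map_add, hs, ht]
    | smul c t ht => simp only [map_smul, ht]
    | word l =>
      -- On words of fewer than three letters both sides vanish, since `sigmaAt σ 1` is zero there
      -- and occurs in both.
      rcases l with _ | ⟨a, _ | ⟨b, _ | ⟨c, l⟩⟩⟩
      · simp
      · simp only [word_cons, word_nil, zero_add, sigmaAt_zero_cons_one, map_zero,
          sigmaAt_succ_cons _ 0, sigmaAt_one, mul_zero]
      · simp only [word_cons, word_nil, zero_add, ← glue_tmul, sigmaAt_zero_glue,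
          sigmaAt_one_glue_one, map_zero]
      · simp only [word_cons, ← glue_tmul, zero_add]
        rw [← glue₃_tmul]
        simp only [sigmaAt_zero_glue₃, sigmaAt_one_glue₃]
        exact congrArg (glue₃ _) (LinearMap.congr_fun hσ _)
  | succ i ih =>
    induction t using cons_induction with
    | one => simp
    | cons a t _ => simp only [sigmaAt_succ_cons, ih]
    | add s t hs ht => simp only [map_add, hs, ht]
    | smul c t ht => simp only [map_smul, ht]

/-- After `i` letters are stripped, one operator changes only the first two letters and the other
only the letters after them. -/
lemma sigmaAt_comm (i j : ℕ) (h : i + 2 ≤ j) :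
    sigmaAt σ i * sigmaAt σ j = sigmaAt σ j * sigmaAt σ i := by
  obtain ⟨j, rfl⟩ := Nat.exists_eq_add_of_le' h
  rw [← add_assoc]
  refine LinearMap.ext fun t => ?_
  simp only [Module.End.mul_apply]
  induction i generalizing t with
  | zero =>
    induction t using cons_induction with
    | one => simp
    | cons a t ht =>
      clear ht
      induction t using cons_induction with
      | one => simp only [sigmaAt_succ_cons, sigmaAt_zero_cons_one, sigmaAt_one, mul_zero,
          map_zero]
      | cons b t _ => simp only [← glue_tmul, sigmaAt_zero_glue, sigmaAt_glue, add_zero]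
      | add s t hs ht => simp only [mul_add, map_add, hs, ht]
      | smul c t ht => simp only [mul_smul_comm, map_smul, ht]
    | add s t hs ht => simp only [map_add, hs, ht]
    | smul c t ht => simp only [map_smul, ht]
  | succ i ih =>
    induction t using cons_induction with
    | one => simp
    | cons a t _ =>
      have := ih (by omega) t
      simp only [← add_assoc, add_right_comm _ 1 2, sigmaAt_succ_cons, this]
    | add s t hs ht => simp only [map_add, hs, ht]
    | smul c t ht => simp only [map_smul, ht]

lemma sigmaAt_mem (i : ℕ) {n : ℕ} {t : TensorAlgebra k V} (ht : t ∈ homog k V n) :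
    sigmaAt σ i t ∈ homog k V n := by
  refine map_homog_le (F := sigmaAt σ i) (fun l hl => ?_) ht
  subst hl
  clear ht
  induction i generalizing l with
  | zero =>
    rcases l with _ | ⟨a, _ | ⟨b, l⟩⟩
    · simp
    · rw [word_cons, word_nil, sigmaAt_zero_cons_one]
      exact Submodule.zero_mem _
    · rw [word_cons, word_cons, sigmaAt_zero_cons_cons]
      induction σ (a ⊗ₜ b) using TensorProduct.induction_on with
      | zero => simp
      | add x y hx hy => rw [map_add]; exact Submodule.add_mem _ hx hy
      | tmul x y => rw [glue_tmul]; exact cons_mem x (cons_mem y (word_mem l))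
  | succ i ih =>
    rcases l with _ | ⟨a, l⟩
    · simp
    · rw [word_cons, sigmaAt_succ_cons]; exact cons_mem a (ih l)

lemma cut_sigmaAt_right (p i : ℕ) (f : TensorAlgebra k V →ₗ[k] M)
    (g : TensorAlgebra k V →ₗ[k] N) (t : TensorAlgebra k V) :
    cut p f g (sigmaAt σ (i + p) t) = cut p f (g ∘ₗ sigmaAt σ i) t := by
  induction p generalizing f t with
  | zero => simp [cut_zero]
  | succ p ih =>
    induction t using cons_induction with
    | one => simp [cut_succ_one]
    | cons a t _ => rw [← add_assoc, sigmaAt_succ_cons, cut_succ_cons, ih, cut_succ_cons]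
    | add s t hs ht => simp only [map_add, hs, ht]
    | smul c t ht => simp only [map_smul, ht]

lemma cut_glue (p : ℕ) (f : TensorAlgebra k V →ₗ[k] M) (g : TensorAlgebra k V →ₗ[k] N)
    (x : V ⊗[k] V) (t : TensorAlgebra k V) :
    cut (p + 2) f g (glue k V x t) = cut p (f ∘ₗ glue k V x) g t := by
  induction x using TensorProduct.induction_on with
  | zero => simp [cut]
  | add x y hx hy =>
    rw [map_add, LinearMap.add_apply, map_add, hx, hy, LinearMap.comp_add, cut, cut, cut,
      TensorProduct.map_add_left, LinearMap.add_comp, LinearMap.add_apply]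
  | tmul x y =>
    rw [glue_tmul, cut_succ_cons, cut_succ_cons]
    congr 2
    refine LinearMap.ext fun t => ?_
    simp

/-- The bound `i + 1 < p` says that both crossing strands lie to the left of the cut. -/
lemma cut_sigmaAt_left {p i : ℕ} (h : i + 1 < p) (f : TensorAlgebra k V →ₗ[k] M)
    (g : TensorAlgebra k V →ₗ[k] N) (t : TensorAlgebra k V) :
    cut p f g (sigmaAt σ i t) = cut p (f ∘ₗ sigmaAt σ i) g t := by
  obtain ⟨p, rfl⟩ : ∃ q, p = q + 1 := ⟨p - 1, by omega⟩
  induction i generalizing p f t with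
  | zero =>
    obtain ⟨p, rfl⟩ : ∃ q, p = q + 1 := ⟨p - 1, by omega⟩
    induction t using cons_induction with
    | one => simp [cut_succ_one]
    | cons a t ht =>
      clear ht
      induction t using cons_induction with
      | one => rw [sigmaAt_zero_cons_one, cut_succ_cons, cut_succ_one, map_zero]
      | cons b t _ =>
        rw [sigmaAt_zero_cons_cons, cut_glue, cut_succ_cons, cut_succ_cons]
        congr 2
        exact LinearMap.ext fun t => congrArg f (sigmaAt_zero_cons_cons σ a b t).symm
      | add s t hs ht => simp only [mul_add, map_add, hs, ht]
      | smul c t ht => simp only [mul_smul_comm, map_smul, ht]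
    | add s t hs ht => simp only [map_add, hs, ht]
    | smul c t ht => simp only [map_smul, ht]
  | succ i ih =>
    obtain ⟨p, rfl⟩ : ∃ q, p = q + 1 := ⟨p - 1, by omega⟩
    induction t using cons_induction with
    | one => simp [cut_succ_one]
    | cons a t _ =>
      rw [sigmaAt_succ_cons, cut_succ_cons, ih _ _ _ (by omega), cut_succ_cons]
      congr 2
      exact LinearMap.ext fun t => congrArg f (sigmaAt_succ_cons σ i a t).symm
    | add s t hs ht => simp only [map_add, hs, ht]
    | smul c t ht => simp only [map_smul, ht]

variable {σ} (hσ : IsBraiding σ)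

/-- The action of the positive braids on `T(V)`. -/
def act : BraidAlgebra k →ₐ[k] Module.End k (TensorAlgebra k V) :=
  BraidAlgebra.lift (sigmaAt σ) (sigmaAt_braid hσ) (sigmaAt_comm σ)

@[simp] lemma act_gen (i : ℕ) : act hσ (gen k i) = sigmaAt σ i := by simp [act]

lemma act_mem (c : BraidAlgebra k) {n : ℕ} {t : TensorAlgebra k V} (ht : t ∈ homog k V n) :
    act hσ c t ∈ homog k V n := by
  induction c using BraidAlgebra.induction generalizing t with
  | algebraMap r => simpa using Submodule.smul_mem _ r ht
  | gen i => simpa using sigmaAt_mem σ i ht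
  | mul x y hx hy => simpa using hx (hy ht)
  | add x y hx hy => simpa using Submodule.add_mem _ (hx ht) (hy ht)

lemma act_sh_cons (c : BraidAlgebra k) (a : V) (t : TensorAlgebra k V) :
    act hσ (sh 1 c) (TensorAlgebra.ι k a * t) = TensorAlgebra.ι k a * act hσ c t := by
  induction c using BraidAlgebra.induction generalizing t with
  | algebraMap r => simp
  | gen i => simp [sigmaAt_succ_cons]
  | mul x y hx hy => simp [hx, hy]
  | add x y hx hy => simp [hx, hy, mul_add]

/-- A braid shifted by `p` acts behind the cut, and by `cut_act` a braid on `p` strands acts before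
it. These two rules translate tensor products of maps into products of braids. -/
lemma cut_act_sh (p : ℕ) (f : TensorAlgebra k V →ₗ[k] M) (g : TensorAlgebra k V →ₗ[k] N)
    (c : BraidAlgebra k) (t : TensorAlgebra k V) :
    cut p f g (act hσ (sh p c) t) = cut p f (g ∘ₗ act hσ c) t := by
  induction c using BraidAlgebra.induction generalizing g t with
  | algebraMap r =>
    simp only [AlgHom.commutes, Module.algebraMap_end_apply, map_smul]
    rw [show g ∘ₗ algebraMap k (Module.End k _) r = r • g from LinearMap.ext fun _ => by simp, cut,
      cut, TensorProduct.map_smul_right, LinearMap.smul_comp, LinearMap.smul_apply]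
  | gen i => simpa using cut_sigmaAt_right σ p i f g t
  | mul x y hx hy => rw [map_mul, map_mul, Module.End.mul_apply, hx, hy, map_mul]; rfl
  | add x y hx hy =>
    rw [map_add, map_add, LinearMap.add_apply, map_add, hx, hy, map_add, LinearMap.comp_add, cut,
      cut, cut, TensorProduct.map_add_right, LinearMap.add_comp, LinearMap.add_apply]

lemma cut_act {p : ℕ} (f : TensorAlgebra k V →ₗ[k] M) (g : TensorAlgebra k V →ₗ[k] N)
    {c : BraidAlgebra k} (hc : c ∈ strands k p) (t : TensorAlgebra k V) :
    cut p f g (act hσ c t) = cut p (f ∘ₗ act hσ c) g t := by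
  induction hc using strands_induction generalizing f t with
  | algebraMap r =>
    simp only [AlgHom.commutes, Module.algebraMap_end_apply, map_smul]
    rw [show f ∘ₗ algebraMap k (Module.End k _) r = r • f from LinearMap.ext fun _ => by simp, cut,
      cut, TensorProduct.map_smul_left, LinearMap.smul_comp, LinearMap.smul_apply]
  | gen i hi => simpa using cut_sigmaAt_left σ hi f g t
  | mul x y _ _ hx hy => rw [map_mul, Module.End.mul_apply, hx, hy]; rfl
  | add x y _ _ hx hy =>
    rw [map_add, LinearMap.add_apply, map_add, hx, hy, LinearMap.comp_add, cut, cut, cut,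
      TensorProduct.map_add_left, LinearMap.add_comp, LinearMap.add_apply]

lemma act_list (l : List ℕ) :
    act hσ (l.map (gen k)).prod = (l.map (sigmaAt σ)).prod := by
  induction l with
  | nil => simp
  | cons i l ih => simp [ih]

lemma act_row_word (a : V) (l : List V) (t : TensorAlgebra k V) :
    act hσ (row k l.length) (word k l * (TensorAlgebra.ι k a * t)) =
      incl k V (letterBraid σ a (word k l)) * t := by
  rw [letterBraid_word, row, act_list]

/-! ## The structure maps as actions of braids -/

/-- This refines `braidT_word` by recovering the two tensor factors, which concatenation forgets.
The recursions agree: `letterBraid` is a row, and the remaining letters give the shifted block. -/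
lemma braidT_word_tmul (l l' : List V) :
    braidT σ (word k l ⊗ₜ word k l') =
      split k V l'.length (act hσ (block k l.length l'.length) (word k l * word k l')) := by
  induction l' generalizing l with
  | nil => simp
  | cons a l' ih =>
    have key := letterBraid_ext (F := (incl k V).rTensor (TensorAlgebra k V) ∘ₗ
        (TensorProduct.assoc k V (TensorAlgebra k V) (TensorAlgebra k V)).symm.toLinearMap ∘ₗ
        (braidT σ ∘ₗ (TensorProduct.mk k _ _).flip (word k l')).lTensor V)
      (G := split k V (l'.length + 1) ∘ₗ act hσ (sh 1 (block k l.length l'.length)) ∘ₗ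
        LinearMap.mulRight k (word k l') ∘ₗ incl k V) σ a l (fun b l₁ hl => by
          have h := ih l₁
          rw [hl] at h
          simp [mul_assoc, act_sh_cons, split, h])
    simp only [LinearMap.comp_apply, LinearEquiv.coe_coe, LinearMap.mulRight_apply] at key
    rw [word_cons, braidT_cons_right, key, List.length_cons, block_succ_right, map_mul (act hσ),
      Module.End.mul_apply, act_row_word]

/-- The formula for `shuffle` is kept as a hypothesis so that this applies both within the induction
for `shuffle_word` and afterwards in `succ_cut`. -/
lemma shuffle_flip_letterBraid (a : V) (l l' : List V)
    (h : ∀ l₁ : List V, l₁.length = l.length → shuffle σ (word k l₁) (word k l') =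
      act hσ (shuf k l.length l'.length) (word k l₁ * word k l')) :
    incl k V (((shuffle σ).flip (word k l')).lTensor V (letterBraid σ a (word k l))) =
      act hσ (rightShuf k l.length (l'.length + 1))
        (word k l * (TensorAlgebra.ι k a * word k l')) := by
  have key := letterBraid_ext (F := incl k V ∘ₗ ((shuffle σ).flip (word k l')).lTensor V)
    (G := act hσ (sh 1 (shuf k l.length l'.length)) ∘ₗ
      LinearMap.mulRight k (word k l') ∘ₗ incl k V) σ a l (fun b l₁ hl => by
        simp [mul_assoc, act_sh_cons, h l₁ hl])
  simp only [LinearMap.comp_apply, LinearMap.mulRight_apply] at key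
  rw [key, rightShuf_succ, map_mul (act hσ), Module.End.mul_apply, act_row_word]

/-- The recursion of the quantum shuffle product is that of `shuf`: its two summands keep the left
front letter or bring the right one forward. The outer induction covers all left words, since
braiding a letter past the left word changes that word. -/
lemma shuffle_word (l l' : List V) :
    shuffle σ (word k l) (word k l') =
      act hσ (shuf k l.length l'.length) (word k l * word k l') := by
  induction l' generalizing l with
  | nil => simp
  | cons a l' ih =>
    induction l with
    | nil => simp
    | cons b l ihl =>
      have h := shuffle_flip_letterBraid hσ a (b :: l) l' (fun l₁ hl => by rw [ih, hl])
      rw [word_cons, word_cons, shuffle_cons_cons, shufflePast_tmul, ← word_cons b, h,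
        ← word_cons, ihl, List.length_cons, List.length_cons,
        shuf_eq_add (k := k) (m := l.length + 1) (by omega), map_add, LinearMap.add_apply,
        leftShuf_succ]
      rw [word_cons b, mul_assoc, act_sh_cons, word_cons]

/-- The first entry of the dictionary between structure maps and braids. Blocks must be nonempty
because `proj` kills `1`. -/
lemma braidTPlus_cut {m n : ℕ} (hm : 1 ≤ m) (hn : 1 ≤ n) {t : TensorAlgebra k V}
    (ht : t ∈ homog k V (m + n)) :
    braidTPlus σ (cut m (proj k V) (proj k V) t) =
      cut n (proj k V) (proj k V) (act hσ (block k m n) t) := by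
  refine eq_on_homog_add (F := braidTPlus σ ∘ₗ cut m (proj k V) (proj k V))
    (G := cut n (proj k V) (proj k V) ∘ₗ act hσ (block k m n)) (fun l l' hl hl' => ?_) ht
  subst hl hl'
  rw [LinearMap.comp_apply, cut_word _ _ _ rfl, LinearMap.comp_apply, braidTPlus,
    LinearMap.comp_apply, LinearMap.comp_apply, TensorProduct.map_tmul, incl_proj_word hm,
    incl_proj_word hn, braidT_word_tmul hσ]
  rfl

lemma prec_cut {m n : ℕ} (hm : 1 ≤ m) (hn : 1 ≤ n) {t : TensorAlgebra k V}
    (ht : t ∈ homog k V (m + n)) :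
    prec σ (cut m (proj k V) (proj k V) t) = proj k V (act hσ (leftShuf k m n) t) := by
  refine eq_on_homog_add (F := prec σ ∘ₗ cut m (proj k V) (proj k V))
    (G := proj k V ∘ₗ act hσ (leftShuf k m n)) (fun l l' hl hl' => ?_) ht
  subst hl hl'
  rcases l with _ | ⟨b, l⟩
  · simp at hm
  rw [LinearMap.comp_apply, cut_word _ _ _ rfl, word_cons, proj_cons, prec_tmul,
    incl_proj_word hn, shuffle_word hσ, LinearMap.comp_apply, List.length_cons, leftShuf_succ,
    mul_assoc, act_sh_cons, proj_cons]

lemma succ_cut {m n : ℕ} (hm : 1 ≤ m) (hn : 1 ≤ n) {t : TensorAlgebra k V}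
    (ht : t ∈ homog k V (m + n)) :
    succ σ (cut m (proj k V) (proj k V) t) = proj k V (act hσ (rightShuf k m n) t) := by
  refine eq_on_homog_add (F := succ σ ∘ₗ cut m (proj k V) (proj k V))
    (G := proj k V ∘ₗ act hσ (rightShuf k m n)) (fun l l' hl hl' => ?_) ht
  subst hl hl'
  rcases l' with _ | ⟨a, l'⟩
  · simp at hn
  rw [LinearMap.comp_apply, cut_word _ _ _ rfl, word_cons, proj_cons, succ_tmul,
    incl_proj_word hm, LinearMap.comp_apply, List.length_cons,
    ← shuffle_flip_letterBraid hσ a l l' (fun l₁ hl => by rw [shuffle_word hσ, hl]), proj_incl]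

lemma star_cut {m n : ℕ} (hm : 1 ≤ m) (hn : 1 ≤ n) {t : TensorAlgebra k V}
    (ht : t ∈ homog k V (m + n)) :
    (prec σ + succ σ) (cut m (proj k V) (proj k V) t) = proj k V (act hσ (shuf k m n) t) := by
  rw [LinearMap.add_apply, prec_cut hσ hm hn ht, succ_cut hσ hm hn ht, ← map_add,
    ← LinearMap.add_apply, ← map_add, ← shuf_eq_add (by omega)]

end Action

/-! ## The braided dendriform Hopf algebra structure -/

section Hopf

variable {k : Type u} [CommRing k] {V : Type v} [AddCommGroup V] [Module k V]
variable {M : Type*} [AddCommGroup M] [Module k M] {N : Type*} [AddCommGroup N] [Module k N]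
variable {σ : V ⊗[k] V →ₗ[k] V ⊗[k] V} (hσ : IsBraiding σ)

open BraidAlgebra

lemma cut_cut_congr {m n p : ℕ} {f : TensorAlgebra k V →ₗ[k] M}
    {g g' : TensorAlgebra k V →ₗ[k] N} {c : BraidAlgebra k} {t : TensorAlgebra k V}
    (ht : t ∈ homog k V (m + n + p)) (h : ∀ x ∈ homog k V (n + p), g x = g' (act hσ c x)) :
    cut m f g t = cut m f g' (act hσ (sh m c) t) := by
  rw [cut_act_sh]
  exact cut_congr (by rwa [← add_assoc]) (fun _ _ => rfl) h

/-- Stated for any product given by a braid, so that it serves `≺`, `≻` and `⋆` alike. -/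
lemma mulRight_cut {μ : TPlus k V ⊗[k] TPlus k V →ₗ[k] TPlus k V} {m n p : ℕ}
    {c : BraidAlgebra k} (h : ∀ t ∈ homog k V (n + p),
      μ (cut n (proj k V) (proj k V) t) = proj k V (act hσ c t))
    {t : TensorAlgebra k V} (ht : t ∈ homog k V (m + n + p)) :
    mulRight μ (cut m (proj k V) (cut n (proj k V) (proj k V)) t) =
      cut m (proj k V) (proj k V) (act hσ (sh m c) t) := by
  rw [mulRight, lTensor_cut]
  exact cut_cut_congr hσ ht h

lemma mulLeft_cut {μ : TPlus k V ⊗[k] TPlus k V →ₗ[k] TPlus k V} {m n p : ℕ}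
    {c : BraidAlgebra k} (hc : c ∈ strands k (m + n)) (h : ∀ t ∈ homog k V (m + n),
      μ (cut m (proj k V) (proj k V) t) = proj k V (act hσ c t))
    {t : TensorAlgebra k V} (ht : t ∈ homog k V (m + n + p)) :
    mulLeft μ (cut m (proj k V) (cut n (proj k V) (proj k V)) t) =
      cut (m + n) (proj k V) (proj k V) (act hσ c t) := by
  rw [mulLeft, LinearMap.comp_apply, LinearEquiv.coe_coe, assoc_symm_cut, rTensor_cut,
    cut_act _ _ _ hc]
  exact cut_congr ht h fun _ _ => rfl

lemma braidFirst_cut {m n p : ℕ} (hm : 1 ≤ m) (hn : 1 ≤ n) (g : TensorAlgebra k V →ₗ[k] N)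
    {t : TensorAlgebra k V} (ht : t ∈ homog k V (m + n + p)) :
    braidFirst (braidTPlus σ) N (cut m (proj k V) (cut n (proj k V) g) t) =
      cut n (proj k V) (cut m (proj k V) g) (act hσ (block k m n) t) := by
  rw [braidFirst, LinearMap.comp_apply, LinearMap.comp_apply, LinearEquiv.coe_coe,
    LinearEquiv.coe_coe, assoc_symm_cut, rTensor_cut, ← assoc_cut, add_comm n m,
    cut_act _ _ _ (block_mem m n)]
  exact congrArg _ (cut_congr ht (fun x hx => braidTPlus_cut hσ hm hn hx) fun _ _ => rfl)

lemma braid₁_cut {m n p : ℕ} (hm : 1 ≤ m) (hn : 1 ≤ n)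
    {t : TensorAlgebra k V} (ht : t ∈ homog k V (m + n + p)) :
    braid₁ (braidTPlus σ) (cut m (proj k V) (cut n (proj k V) (proj k V)) t) =
      cut n (proj k V) (cut m (proj k V) (proj k V)) (act hσ (block k m n) t) :=
  braidFirst_cut hσ hm hn _ ht

lemma braid₂_cut {m n p : ℕ} (hn : 1 ≤ n) (hp : 1 ≤ p)
    {t : TensorAlgebra k V} (ht : t ∈ homog k V (m + n + p)) :
    braid₂ (braidTPlus σ) (cut m (proj k V) (cut n (proj k V) (proj k V)) t) =
      cut m (proj k V) (cut p (proj k V) (proj k V)) (act hσ (sh m (block k n p)) t) := by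
  rw [braid₂, lTensor_cut]
  exact cut_cut_congr hσ ht fun x hx => braidTPlus_cut hσ hn hp hx

lemma braidMid_cut {a b c d : ℕ} (hb : 1 ≤ b) (hc : 1 ≤ c)
    {t : TensorAlgebra k V} (ht : t ∈ homog k V (a + b + c + d)) :
    braidMid (braidTPlus σ) (cut (a + b) (cut a (proj k V) (proj k V))
        (cut c (proj k V) (proj k V)) t) =
      cut (a + c) (cut a (proj k V) (proj k V)) (cut b (proj k V) (proj k V))
        (act hσ (sh a (block k b c)) t) := by
  rw [braidMid, LinearMap.comp_apply, LinearMap.comp_apply, LinearEquiv.coe_coe,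
    LinearEquiv.coe_coe, assoc_cut, lTensor_cut, ← assoc_symm_cut]
  refine congrArg _ (cut_cut_congr hσ (n := b) (p := c + d) (by rwa [← add_assoc]) fun x hx => ?_)
  exact braidFirst_cut hσ hb hc _ (by rwa [add_assoc])

lemma act_act (c d : BraidAlgebra k) (t : TensorAlgebra k V) :
    act hσ c (act hσ d t) = act hσ (c * d) t := by
  rw [map_mul]; rfl

lemma homog_cast {m n : ℕ} {t : TensorAlgebra k V} (ht : t ∈ homog k V m) (h : m = n) :
    t ∈ homog k V n := h ▸ ht

/-- On blocks of lengths `m`, `n`, `p` this is `block_yang_baxter`. -/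
lemma isBraiding_braidTPlus (hσ : IsBraiding σ) : IsBraiding (braidTPlus σ) := by
  refine TPlus.hom_ext₃ fun m n p hm hn hp t ht => ?_
  simp only [LinearMap.comp_apply]
  rw [braid₁_cut hσ hm hn ht,
    braid₂_cut hσ (m := n) hm hp (act_mem hσ _ (homog_cast ht (by omega))),
    braid₁_cut hσ (p := m) hn hp (act_mem hσ _ (act_mem hσ _ (homog_cast ht (by omega)))),
    braid₂_cut hσ hn hp ht, braid₁_cut hσ (p := n) hm hp (act_mem hσ _ (homog_cast ht (by omega))),
    braid₂_cut hσ (m := p) hm hn (act_mem hσ _ (act_mem hσ _ (homog_cast ht (by omega)))),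
    act_act, act_act, act_act, act_act, mul_assoc, block_yang_baxter, mul_assoc]

/-- A product given by a braid on its own strands slides through the transposition with a third
block, and that transposition splits by `block_add_right`. In `braid_mul_id` the mirror images
`block_mul` and `block_add_left` are used. -/
lemma braid_id_mul {μ : TPlus k V ⊗[k] TPlus k V →ₗ[k] TPlus k V} {c : ℕ → ℕ → BraidAlgebra k}
    (hc : ∀ m n, c m n ∈ strands k (m + n))
    (h : ∀ m n, 1 ≤ m → 1 ≤ n → ∀ t ∈ homog k V (m + n),
      μ (cut m (proj k V) (proj k V) t) = proj k V (act hσ (c m n) t)) :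
    braidTPlus σ ∘ₗ mulRight μ =
      mulLeft μ ∘ₗ braid₂ (braidTPlus σ) ∘ₗ braid₁ (braidTPlus σ) := by
  refine TPlus.hom_ext₃ fun m n p hm hn hp t ht => ?_
  simp only [LinearMap.comp_apply]
  rw [mulRight_cut hσ (h n p hn hp) ht,
    braidTPlus_cut hσ hm (by omega : 1 ≤ n + p) (act_mem hσ _ (homog_cast ht (by omega))),
    braid₁_cut hσ hm hn ht,
    braid₂_cut hσ (m := n) hm hp (act_mem hσ _ (homog_cast ht (by omega))),
    mulLeft_cut hσ (p := m) (hc n p) (h n p hn hp)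
      (act_mem hσ _ (act_mem hσ _ (homog_cast ht (by omega)))),
    act_act, act_act, act_act, block_mul_sh (hc n p), mul_assoc, ← block_add_right]

lemma braid_mul_id {μ : TPlus k V ⊗[k] TPlus k V →ₗ[k] TPlus k V} {c : ℕ → ℕ → BraidAlgebra k}
    (hc : ∀ m n, c m n ∈ strands k (m + n))
    (h : ∀ m n, 1 ≤ m → 1 ≤ n → ∀ t ∈ homog k V (m + n),
      μ (cut m (proj k V) (proj k V) t) = proj k V (act hσ (c m n) t)) :
    braidTPlus σ ∘ₗ mulLeft μ =
      mulRight μ ∘ₗ braid₁ (braidTPlus σ) ∘ₗ braid₂ (braidTPlus σ) := by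
  refine TPlus.hom_ext₃ fun m n p hm hn hp t ht => ?_
  simp only [LinearMap.comp_apply]
  rw [mulLeft_cut hσ (hc m n) (h m n hm hn) ht,
    braidTPlus_cut hσ (by omega : 1 ≤ m + n) hp (act_mem hσ _ ht),
    braid₂_cut hσ hn hp ht,
    braid₁_cut hσ (p := n) hm hp (act_mem hσ _ (homog_cast ht (by omega))),
    mulRight_cut hσ (m := p) (h m n hm hn) (act_mem hσ _ (act_mem hσ _ (homog_cast ht (by omega)))),
    act_act, act_act, act_act, block_mul (hc m n), mul_assoc, ← block_add_left]

/-- The three axioms correspond to a front strand from the first, second and third block, that is,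
to the three parts of `shuf_assoc`. -/
lemma isDendriform_prec_succ (hσ : IsBraiding σ) : IsDendriform (prec σ) (succ σ) := by
  have hp := fun m n hm hn t ht => prec_cut hσ (m := m) (n := n) hm hn (t := t) ht
  have hs := fun m n hm hn t ht => succ_cut hσ (m := m) (n := n) hm hn (t := t) ht
  have hst := fun m n hm hn t ht => star_cut hσ (m := m) (n := n) hm hn (t := t) ht
  have h1 : prec σ ∘ₗ mulLeft (prec σ) = prec σ ∘ₗ mulRight (prec σ + succ σ) := by
    refine TPlus.hom_ext₃ fun m n p hm hn hp' t ht => ?_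
    simp only [LinearMap.comp_apply]
    rw [mulLeft_cut hσ (leftShuf_mem m n) (hp m n hm hn) ht,
      hp _ _ (by omega) hp' _ (act_mem hσ _ ht), mulRight_cut hσ (hst n p hn hp') ht,
      hp m (n + p) hm (by omega) _ (act_mem hσ _ (homog_cast ht (by omega))), act_act, act_act,
      leftShuf_mul_leftShuf hm]
  have h2 : prec σ ∘ₗ mulLeft (succ σ) = succ σ ∘ₗ mulRight (prec σ) := by
    refine TPlus.hom_ext₃ fun m n p hm hn hp' t ht => ?_
    simp only [LinearMap.comp_apply]
    rw [mulLeft_cut hσ (rightShuf_mem m n) (hs m n hm hn) ht,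
      hp _ _ (by omega) hp' _ (act_mem hσ _ ht), mulRight_cut hσ (hp n p hn hp') ht,
      hs m (n + p) hm (by omega) _ (act_mem hσ _ (homog_cast ht (by omega))), act_act, act_act,
      leftShuf_mul_rightShuf _ hn]
  have h3 : succ σ ∘ₗ mulRight (succ σ) = succ σ ∘ₗ mulLeft (prec σ + succ σ) := by
    refine TPlus.hom_ext₃ fun m n p hm hn hp' t ht => ?_
    simp only [LinearMap.comp_apply]
    rw [mulLeft_cut hσ (shuf_mem m n) (hst m n hm hn) ht,
      hs _ _ (by omega) hp' _ (act_mem hσ _ ht), mulRight_cut hσ (hs n p hn hp') ht,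
      hs m (n + p) hm (by omega) _ (act_mem hσ _ (homog_cast ht (by omega))), act_act, act_act,
      rightShuf_mul_shuf _ _ hp']
  refine ⟨fun x y z => ?_, fun x y z => ?_, fun x y z => ?_⟩
  · simpa [mulLeft, mulRight, TensorProduct.tmul_add, TensorProduct.add_tmul] using LinearMap.congr_fun h1 (x ⊗ₜ (y ⊗ₜ z))
  · simpa [mulLeft, mulRight, TensorProduct.tmul_add, TensorProduct.add_tmul] using LinearMap.congr_fun h2 (x ⊗ₜ (y ⊗ₜ z))
  · simpa [mulLeft, mulRight, TensorProduct.tmul_add, TensorProduct.add_tmul] using LinearMap.congr_fun h3 (x ⊗ₜ (y ⊗ₜ z))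

lemma isBraidedDendriform_prec_succ (hσ : IsBraiding σ) : IsBraidedDendriform (prec σ) (succ σ) (braidTPlus σ) where
  isBraiding := isBraiding_braidTPlus hσ
  isDendriform := isDendriform_prec_succ hσ
  braid_id_prec := braid_id_mul hσ leftShuf_mem fun _ _ hm hn _ ht => prec_cut hσ hm hn ht
  braid_prec_id := braid_mul_id hσ leftShuf_mem fun _ _ hm hn _ ht => prec_cut hσ hm hn ht
  braid_id_succ := braid_id_mul hσ rightShuf_mem fun _ _ hm hn _ ht => succ_cut hσ hm hn ht
  braid_succ_id := braid_mul_id hσ rightShuf_mem fun _ _ hm hn _ ht => succ_cut hσ hm hn ht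

/-! ### The coproduct -/

lemma reducedDeconcat_comp_proj {n : ℕ} {t : TensorAlgebra k V} (ht : t ∈ homog k V n) :
    (reducedDeconcat k V ∘ₗ proj k V) t =
      (∑ r ∈ Finset.Ico 1 n, cut r (proj k V) (proj k V)) t := by
  rw [LinearMap.sum_apply]
  exact reducedDeconcat_proj ht

lemma comulLeft_cut {m n : ℕ} {t : TensorAlgebra k V} (ht : t ∈ homog k V (m + n)) :
    comulLeft (reducedDeconcat k V) (cut m (proj k V) (proj k V) t) =
      ∑ i ∈ Finset.Ico 1 m, cut i (proj k V) (cut (m - i) (proj k V) (proj k V)) t := by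
  rw [comulLeft, LinearMap.comp_apply, rTensor_cut,
    cut_congr ht (fun x hx => reducedDeconcat_comp_proj hx) (fun _ _ => rfl), cut_sum_left,
    LinearEquiv.coe_coe, map_sum]
  refine Finset.sum_congr rfl fun i hi => ?_
  rw [← assoc_cut, Nat.add_sub_of_le (Finset.mem_Ico.1 hi).2.le]

lemma comulRight_cut {m n : ℕ} {t : TensorAlgebra k V} (ht : t ∈ homog k V (m + n)) :
    comulRight (reducedDeconcat k V) (cut m (proj k V) (proj k V) t) =
      ∑ j ∈ Finset.Ico 1 n, cut m (proj k V) (cut j (proj k V) (proj k V)) t := by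
  rw [comulRight, lTensor_cut,
    cut_congr ht (fun _ _ => rfl) (fun x hx => reducedDeconcat_comp_proj hx), cut_sum_right]

lemma map_comul_cut {m n : ℕ} {t : TensorAlgebra k V} (ht : t ∈ homog k V (m + n)) :
    TensorProduct.map (reducedDeconcat k V) (reducedDeconcat k V)
        (cut m (proj k V) (proj k V) t) =
      ∑ i ∈ Finset.Ico 1 m, ∑ j ∈ Finset.Ico 1 n,
        cut m (cut i (proj k V) (proj k V)) (cut j (proj k V) (proj k V)) t := by
  rw [map_cut, cut_congr ht (fun x hx => reducedDeconcat_comp_proj hx)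
    (fun x hx => reducedDeconcat_comp_proj hx), cut_sum_left]
  exact Finset.sum_congr rfl fun i _ => cut_sum_right _ _ _ _ _

lemma reducedDeconcat_coassoc : comulLeft (reducedDeconcat k V) ∘ₗ reducedDeconcat k V =
    comulRight (reducedDeconcat k V) ∘ₗ reducedDeconcat k V := by
  refine TPlus.hom_ext fun l _ => ?_
  have hl := word_mem (k := k) l
  rw [LinearMap.comp_apply, LinearMap.comp_apply, reducedDeconcat_proj hl, map_sum, map_sum]
  have h1 : ∀ r ∈ Finset.Ico 1 l.length,
      comulLeft (reducedDeconcat k V) (cut r (proj k V) (proj k V) (word k l)) = _ :=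
    fun r hr => comulLeft_cut (n := l.length - r)
      (homog_cast hl (by have := Finset.mem_Ico.1 hr; omega))
  have h2 : ∀ r ∈ Finset.Ico 1 l.length,
      comulRight (reducedDeconcat k V) (cut r (proj k V) (proj k V) (word k l)) = _ :=
    fun r hr => comulRight_cut (n := l.length - r)
      (homog_cast hl (by have := Finset.mem_Ico.1 hr; omega))
  rw [Finset.sum_congr rfl h1, Finset.sum_congr rfl h2, Finset.sum_sigma', Finset.sum_sigma']
  -- Both sums run over pairs of cut places. Cutting at `r` and then the front part at `i` gives
  -- blocks of lengths `i`, `r - i` and the rest, as does cutting at `i` and then the tail at `r -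
  -- i`.
  refine Finset.sum_bij' (fun x _ => ⟨x.2, x.1 - x.2⟩) (fun x _ => ⟨x.1 + x.2, x.1⟩)
    ?_ ?_ ?_ ?_ ?_
  · rintro ⟨i, j⟩ h
    simp only [Finset.mem_sigma, Finset.mem_Ico] at h ⊢
    omega
  · rintro ⟨i, j⟩ h
    simp only [Finset.mem_sigma, Finset.mem_Ico] at h ⊢
    omega
  · rintro ⟨i, j⟩ h
    simp only [Finset.mem_sigma, Finset.mem_Ico] at h
    simp only [Sigma.mk.injEq, heq_eq_eq, and_true]
    omega
  · rintro ⟨i, j⟩ h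
    simp
  · rintro ⟨i, j⟩ h
    rfl

/-- A sum over a grid without two opposite corners, grouped by the antidiagonals. -/
lemma sum_grid {M : Type*} [AddCommMonoid M] {m n : ℕ} (hm : 1 ≤ m) (hn : 1 ≤ n)
    (f : ℕ → ℕ → M) :
    (∑ r ∈ Finset.Ico 1 (m + n), ∑ i ∈ Finset.range (m + 1), ∑ j ∈ Finset.range (n + 1),
        if i + j = r then f i j else 0) =
      (∑ i ∈ Finset.Ico 1 m, ∑ j ∈ Finset.Ico 1 n, f i j) + (∑ i ∈ Finset.Ico 1 m, f i 0)
        + (∑ i ∈ Finset.Ico 1 m, f i n) + (∑ j ∈ Finset.Ico 1 n, f m j)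
        + (∑ j ∈ Finset.Ico 1 n, f 0 j) + f m 0 + f 0 n := by
  have split : ∀ {m : ℕ} (_ : 1 ≤ m) (g : ℕ → M), ∑ i ∈ Finset.range (m + 1), g i =
      g 0 + ∑ i ∈ Finset.Ico 1 m, g i + g m := fun {m} hm g => by
    rw [Finset.sum_range_succ, Finset.range_eq_Ico, Finset.sum_eq_sum_Ico_succ_bot (by omega)]
  rw [Finset.sum_comm]
  -- Summing over `r` leaves the condition `1 ≤ i + j < m + n`, which removes exactly the corners
  -- `(0, 0)` and `(m, n)`.
  have h : ∀ i ∈ Finset.range (m + 1), (∑ r ∈ Finset.Ico 1 (m + n),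
      ∑ j ∈ Finset.range (n + 1), if i + j = r then f i j else 0) =
      ∑ j ∈ Finset.range (n + 1), if 1 ≤ i + j ∧ i + j < m + n then f i j else 0 := fun i _ => by
    rw [Finset.sum_comm]
    exact Finset.sum_congr rfl fun j _ => by simp
  have h' : ∀ i ∈ Finset.Ico 1 m, (∑ j ∈ Finset.range (n + 1),
      if 1 ≤ i + j ∧ i + j < m + n then f i j else 0) =
      f i 0 + (∑ j ∈ Finset.Ico 1 n, f i j) + f i n := fun i hi => by
    rw [Finset.mem_Ico] at hi
    rw [← split hn]
    refine Finset.sum_congr rfl fun j hj => if_pos ?_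
    rw [Finset.mem_range] at hj
    omega
  have h0 : (∑ j ∈ Finset.range (n + 1), if 1 ≤ 0 + j ∧ 0 + j < m + n then f 0 j else 0) =
      (∑ j ∈ Finset.Ico 1 n, f 0 j) + f 0 n := by
    rw [split hn, if_neg (by omega), if_pos (by omega), zero_add]
    congr 1
    refine Finset.sum_congr rfl fun j hj => if_pos ?_
    rw [Finset.mem_Ico] at hj
    omega
  have hm' : (∑ j ∈ Finset.range (n + 1), if 1 ≤ m + j ∧ m + j < m + n then f m j else 0) =
      f m 0 + (∑ j ∈ Finset.Ico 1 n, f m j) := by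
    rw [split hn, if_pos (by omega), if_neg (by omega), add_zero]
    congr 1
    refine Finset.sum_congr rfl fun j hj => if_pos ?_
    rw [Finset.mem_Ico] at hj
    omega
  rw [Finset.sum_congr rfl h, split hm, Finset.sum_congr rfl h', h0, hm', Finset.sum_add_distrib,
    Finset.sum_add_distrib]
  abel

/-! ### The terms of the coproduct of a product, matched with points of the grid. -/

section Comul

variable {μ : TPlus k V ⊗[k] TPlus k V →ₗ[k] TPlus k V} {c : ℕ → ℕ → BraidAlgebra k}

variable (c) in
/-- The part of the coproduct of a product of `m` and `n` letters whose first factor is made of the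
first `i` letters of the left and the first `j` letters of the right argument. -/
def comulTerm (m n : ℕ) (t : TensorAlgebra k V) (i j : ℕ) : TPlus k V ⊗[k] TPlus k V :=
  cut (i + j) (proj k V) (proj k V) (act hσ (c i j * shufRest k m n i j) t)

/-- The summands on the right are the interior of the grid, its four edges and the two corners `(m,
0)` and `(0, n)`; each will match one term of a coproduct axiom or vanish. -/
lemma comul_mul_cut {m n : ℕ} (hm : 1 ≤ m) (hn : 1 ≤ n)
    (hμ : ∀ m n, 1 ≤ m → 1 ≤ n → ∀ t ∈ homog k V (m + n),
      μ (cut m (proj k V) (proj k V) t) = proj k V (act hσ (c m n) t))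
    (hsum : ∀ r, 1 ≤ r → r ≤ m + n → c m n = ∑ i ∈ Finset.range (m + 1),
      ∑ j ∈ Finset.range (n + 1), if i + j = r then c i j * shufRest k m n i j else 0)
    {t : TensorAlgebra k V} (ht : t ∈ homog k V (m + n)) :
    reducedDeconcat k V (μ (cut m (proj k V) (proj k V) t)) =
      (∑ i ∈ Finset.Ico 1 m, ∑ j ∈ Finset.Ico 1 n, comulTerm hσ c m n t i j)
        + (∑ i ∈ Finset.Ico 1 m, comulTerm hσ c m n t i 0)
        + (∑ i ∈ Finset.Ico 1 m, comulTerm hσ c m n t i n)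
        + (∑ j ∈ Finset.Ico 1 n, comulTerm hσ c m n t m j)
        + (∑ j ∈ Finset.Ico 1 n, comulTerm hσ c m n t 0 j)
        + comulTerm hσ c m n t m 0 + comulTerm hσ c m n t 0 n := by
  rw [hμ m n hm hn t ht, reducedDeconcat_proj (act_mem hσ _ ht), ← sum_grid hm hn]
  refine Finset.sum_congr rfl fun r hr => ?_
  rw [Finset.mem_Ico] at hr
  -- Each cut place `r` uses its own factorization of the same braid `c m n`.
  conv_lhs => rw [hsum r hr.1 hr.2.le]
  simp only [map_sum, LinearMap.sum_apply]
  refine Finset.sum_congr rfl fun i _ => Finset.sum_congr rfl fun j _ => ?_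
  split_ifs with h
  · rw [comulTerm, h]
  · simp

/-- The middle braiding exchanges the last `m - i` left letters with the first `j` right ones; then
`c i j` acts on the front and a shuffle on the back. The last two braids act on disjoint strands,
and the product is `c i j * shufRest k m n i j`. -/
lemma map_mul_braidMid_cut {m n : ℕ} (hc : ∀ m n, c m n ∈ strands k (m + n))
    (hμ : ∀ m n, 1 ≤ m → 1 ≤ n → ∀ t ∈ homog k V (m + n),
      μ (cut m (proj k V) (proj k V) t) = proj k V (act hσ (c m n) t))
    {t : TensorAlgebra k V} (ht : t ∈ homog k V (m + n)) :
    TensorProduct.map μ (prec σ + succ σ) (braidMid (braidTPlus σ)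
      (TensorProduct.map (reducedDeconcat k V) (reducedDeconcat k V)
        (cut m (proj k V) (proj k V) t))) =
      ∑ i ∈ Finset.Ico 1 m, ∑ j ∈ Finset.Ico 1 n, comulTerm hσ c m n t i j := by
  rw [map_comul_cut ht]
  simp only [map_sum]
  refine Finset.sum_congr rfl fun i hi => Finset.sum_congr rfl fun j hj => ?_
  rw [Finset.mem_Ico] at hi hj
  obtain ⟨b, rfl⟩ := Nat.exists_eq_add_of_le hi.2.le
  obtain ⟨d, rfl⟩ := Nat.exists_eq_add_of_le hj.2.le
  rw [braidMid_cut hσ (d := d) (by omega) hj.1 (homog_cast ht (by omega)), map_cut,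
    cut_congr (act_mem hσ _ (homog_cast ht (by omega : _ = i + j + (b + d))))
      (f' := proj k V ∘ₗ act hσ (c i j)) (g' := proj k V ∘ₗ act hσ (shuf k b d))
      (hμ i j hi.1 hj.1) (fun x hx => star_cut hσ (by omega) (by omega) hx),
    ← cut_act_sh, ← cut_act _ _ _ (hc i j), act_act, act_act, comulTerm, shufRest,
    Nat.add_sub_cancel_left, Nat.add_sub_cancel_left, mul_assoc]

lemma mulRight_comulLeft_cut {m n : ℕ} (hn : 1 ≤ n) {t : TensorAlgebra k V}
    (ht : t ∈ homog k V (m + n)) :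
    mulRight (prec σ + succ σ) (comulLeft (reducedDeconcat k V)
        (cut m (proj k V) (proj k V) t)) =
      ∑ i ∈ Finset.Ico 1 m, cut i (proj k V) (proj k V) (act hσ (sh i (shuf k (m - i) n)) t) := by
  rw [comulLeft_cut ht, map_sum]
  refine Finset.sum_congr rfl fun i hi => ?_
  rw [Finset.mem_Ico] at hi
  exact mulRight_cut hσ (fun x hx => star_cut hσ (by omega) hn hx) (homog_cast ht (by omega))

lemma mulLeft_braid₂_comulLeft_cut {m n : ℕ} (hn : 1 ≤ n) (hc : ∀ m n, c m n ∈ strands k (m + n))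
    (hμ : ∀ m n, 1 ≤ m → 1 ≤ n → ∀ t ∈ homog k V (m + n),
      μ (cut m (proj k V) (proj k V) t) = proj k V (act hσ (c m n) t))
    {t : TensorAlgebra k V} (ht : t ∈ homog k V (m + n)) :
    mulLeft μ (braid₂ (braidTPlus σ) (comulLeft (reducedDeconcat k V)
        (cut m (proj k V) (proj k V) t))) =
      ∑ i ∈ Finset.Ico 1 m, comulTerm hσ c m n t i n := by
  rw [comulLeft_cut ht]
  simp only [map_sum]
  refine Finset.sum_congr rfl fun i hi => ?_
  rw [Finset.mem_Ico] at hi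
  rw [braid₂_cut hσ (p := n) (by omega) hn (homog_cast ht (by omega)),
    mulLeft_cut hσ (p := m - i) (hc i n) (hμ i n hi.1 hn)
      (act_mem hσ _ (homog_cast ht (by omega))), act_act, comulTerm, shufRest, Nat.sub_self,
    shuf_zero_right, map_one, one_mul]

lemma mulLeft_comulRight_cut {m n : ℕ} (hm : 1 ≤ m) (hc : ∀ m n, c m n ∈ strands k (m + n))
    (hμ : ∀ m n, 1 ≤ m → 1 ≤ n → ∀ t ∈ homog k V (m + n),
      μ (cut m (proj k V) (proj k V) t) = proj k V (act hσ (c m n) t))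
    {t : TensorAlgebra k V} (ht : t ∈ homog k V (m + n)) :
    mulLeft μ (comulRight (reducedDeconcat k V) (cut m (proj k V) (proj k V) t)) =
      ∑ j ∈ Finset.Ico 1 n, comulTerm hσ c m n t m j := by
  rw [comulRight_cut ht, map_sum]
  refine Finset.sum_congr rfl fun j hj => ?_
  rw [Finset.mem_Ico] at hj
  rw [mulLeft_cut hσ (p := n - j) (hc m j) (hμ m j hm hj.1) (homog_cast ht (by omega)),
    comulTerm, shufRest, Nat.sub_self, shuf_zero_left, block_zero_left, map_one, map_one, mul_one,
    mul_one]

lemma mulRight_braid₁_comulRight_cut {m n : ℕ} (hm : 1 ≤ m) {t : TensorAlgebra k V}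
    (ht : t ∈ homog k V (m + n)) :
    mulRight (prec σ + succ σ) (braid₁ (braidTPlus σ) (comulRight (reducedDeconcat k V)
        (cut m (proj k V) (proj k V) t))) =
      ∑ j ∈ Finset.Ico 1 n, cut j (proj k V) (proj k V)
        (act hσ (sh j (shuf k m (n - j)) * block k m j) t) := by
  rw [comulRight_cut ht]
  simp only [map_sum]
  refine Finset.sum_congr rfl fun j hj => ?_
  rw [Finset.mem_Ico] at hj
  rw [braid₁_cut hσ (p := n - j) hm hj.1 (homog_cast ht (by omega)),
    mulRight_cut hσ (fun x hx => star_cut hσ (n := n - j) hm (by omega) hx)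
      (act_mem hσ _ (homog_cast ht (by omega))), act_act]

end Comul

lemma comulTerm_leftShuf_zero_left (m n : ℕ) (t : TensorAlgebra k V) (j : ℕ) :
    comulTerm hσ (leftShuf k) m n t 0 j = 0 := by
  simp [comulTerm]

lemma comulTerm_leftShuf_zero_right (m n : ℕ) (t : TensorAlgebra k V) {i : ℕ} (hi : 1 ≤ i) :
    comulTerm hσ (leftShuf k) m n t i 0 =
      cut i (proj k V) (proj k V) (act hσ (sh i (shuf k (m - i) n)) t) := by
  simp [comulTerm, shufRest, leftShuf_zero_right hi]

lemma comulTerm_rightShuf_zero_right (m n : ℕ) (t : TensorAlgebra k V) (i : ℕ) :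
    comulTerm hσ (rightShuf k) m n t i 0 = 0 := by
  simp [comulTerm]

lemma comulTerm_rightShuf_zero_left (m n : ℕ) (t : TensorAlgebra k V) {j : ℕ} (hj : 1 ≤ j) :
    comulTerm hσ (rightShuf k) m n t 0 j =
      cut j (proj k V) (proj k V) (act hσ (sh j (shuf k m (n - j)) * block k m j) t) := by
  simp [comulTerm, shufRest, rightShuf_zero_left hj]

/-- The interior gives `(≺ ⊗ ⋆)τ₂(Δ̄ ⊗ Δ̄)`, the edge `j = 0` gives `id ⊗ ⋆`, the edge `j = n` gives
`(≺ ⊗ id)τ₂`, the edge `i = m` gives `(≺ ⊗ id)(id ⊗ Δ̄)`, and the corner `(m, 0)` gives the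
identity. Terms with `i = 0` vanish: the front letter comes from the left. -/
lemma reducedDeconcat_prec (hσ : IsBraiding σ) :
    reducedDeconcat k V ∘ₗ prec σ =
      TensorProduct.map (prec σ) (prec σ + succ σ) ∘ₗ braidMid (braidTPlus σ) ∘ₗ
        TensorProduct.map (reducedDeconcat k V) (reducedDeconcat k V)
      + (mulRight (prec σ + succ σ) + mulLeft (prec σ) ∘ₗ braid₂ (braidTPlus σ)) ∘ₗ
        comulLeft (reducedDeconcat k V)
      + mulLeft (prec σ) ∘ₗ comulRight (reducedDeconcat k V)
      + LinearMap.id := by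
  refine TPlus.hom_ext₂ fun m n hm hn t ht => ?_
  have hμ := fun m n hm hn t ht => prec_cut hσ (m := m) (n := n) hm hn (t := t) ht
  simp only [LinearMap.add_apply, LinearMap.comp_apply, LinearMap.id_apply]
  rw [comul_mul_cut hσ hm hn hμ (fun r h1 h2 => leftShuf_eq_sum h1 h2) ht,
    map_mul_braidMid_cut hσ leftShuf_mem hμ ht, mulRight_comulLeft_cut hσ hn ht,
    mulLeft_braid₂_comulLeft_cut hσ hn leftShuf_mem hμ ht,
    mulLeft_comulRight_cut hσ hm leftShuf_mem hμ ht, comulTerm_leftShuf_zero_right _ _ _ _ hm,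
    Finset.sum_congr rfl fun i hi =>
      comulTerm_leftShuf_zero_right hσ m n t (Finset.mem_Ico.1 hi).1]
  simp only [comulTerm_leftShuf_zero_left, Finset.sum_const_zero, Nat.sub_self, shuf_zero_left,
    map_one, Module.End.one_apply]
  abel

/-- Here the terms with `j = 0` vanish. The edge `i = 0` gives `(id ⊗ ⋆)τ₁`, the corner `(0, n)`
gives the braiding, and the interior and the edges `j = n` and `i = m` are as for `≺`. -/
lemma reducedDeconcat_succ (hσ : IsBraiding σ) :
    reducedDeconcat k V ∘ₗ succ σ =
      TensorProduct.map (succ σ) (prec σ + succ σ) ∘ₗ braidMid (braidTPlus σ) ∘ₗ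
        TensorProduct.map (reducedDeconcat k V) (reducedDeconcat k V)
      + (mulLeft (succ σ) ∘ₗ braid₂ (braidTPlus σ)) ∘ₗ comulLeft (reducedDeconcat k V)
      + (mulLeft (succ σ) + mulRight (prec σ + succ σ) ∘ₗ braid₁ (braidTPlus σ)) ∘ₗ
        comulRight (reducedDeconcat k V)
      + braidTPlus σ := by
  refine TPlus.hom_ext₂ fun m n hm hn t ht => ?_
  have hμ := fun m n hm hn t ht => succ_cut hσ (m := m) (n := n) hm hn (t := t) ht
  simp only [LinearMap.add_apply, LinearMap.comp_apply]
  rw [comul_mul_cut hσ hm hn hμ (fun r h1 h2 => rightShuf_eq_sum h1 h2) ht,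
    map_mul_braidMid_cut hσ rightShuf_mem hμ ht, mulRight_braid₁_comulRight_cut hσ hm ht,
    mulLeft_braid₂_comulLeft_cut hσ hn rightShuf_mem hμ ht,
    mulLeft_comulRight_cut hσ hm rightShuf_mem hμ ht, comulTerm_rightShuf_zero_left _ _ _ _ hn,
    braidTPlus_cut hσ hm hn ht,
    Finset.sum_congr rfl fun j hj =>
      comulTerm_rightShuf_zero_left hσ m n t (Finset.mem_Ico.1 hj).1]
  simp only [comulTerm_rightShuf_zero_right, Finset.sum_const_zero, Nat.sub_self, shuf_zero_right,
    map_one, one_mul]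
  abel

/-- The quantum shuffle algebra is a braided dendriform Hopf algebra. -/
lemma isBraidedDendriformHopf (hσ : IsBraiding σ) :
    IsBraidedDendriformHopf (prec σ) (succ σ) (reducedDeconcat k V) (braidTPlus σ) where
  isBraidedDendriform := isBraidedDendriform_prec_succ hσ
  coassoc := reducedDeconcat_coassoc
  comul_prec := reducedDeconcat_prec hσ
  comul_succ := reducedDeconcat_succ hσ

end Hopf

/-! ### The counit -/

section Counit

variable {k : Type u} [CommRing k] {V : Type v} [AddCommGroup V] [Module k V]

lemma rTensor_counit_deconcat (t : TensorAlgebra k V) :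
    (counit k V).rTensor _ (deconcat t) = 1 ⊗ₜ t := by
  induction t using cons_induction with
  | one => simp
  | cons a t _ =>
    have h : counit k V ∘ₗ LinearMap.mul k _ (TensorAlgebra.ι k a) = 0 :=
      LinearMap.ext fun x => counit_cons a x
    rw [deconcat_cons, map_add, ← LinearMap.comp_apply, ← LinearMap.comp_apply,
      ← LinearMap.rTensor_comp, h]
    simp
  | add s t hs ht => simp only [map_add, hs, ht, TensorProduct.tmul_add]
  | smul c t ht => simp only [map_smul, ht, TensorProduct.tmul_smul]

lemma lTensor_counit_deconcat (t : TensorAlgebra k V) :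
    (counit k V).lTensor _ (deconcat t) = t ⊗ₜ 1 := by
  induction t using cons_induction with
  | one => simp
  | cons a t ht =>
    rw [deconcat_cons, map_add, ← LinearMap.comp_apply (LinearMap.lTensor _ _) (LinearMap.rTensor _ _),
      LinearMap.lTensor_comp_rTensor, ← LinearMap.rTensor_comp_lTensor, LinearMap.comp_apply, ht]
    simp
  | add s t hs ht => simp only [map_add, hs, ht, TensorProduct.add_tmul]
  | smul c t ht => simp only [map_smul, ht, TensorProduct.smul_tmul']

/-- Since `incl ∘ proj` is `id - ε(·)1`, this is its tensor square multiplied out. -/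
lemma map_incl_proj (z : TensorAlgebra k V ⊗[k] TensorAlgebra k V) :
    TensorProduct.map (incl k V ∘ₗ proj k V) (incl k V ∘ₗ proj k V) z =
      z - TensorProduct.map (LinearMap.toSpanSingleton k _ 1) LinearMap.id
          ((counit k V).rTensor _ z)
        - TensorProduct.map LinearMap.id (LinearMap.toSpanSingleton k _ 1)
          ((counit k V).lTensor _ z)
        + TensorProduct.map (LinearMap.toSpanSingleton k _ 1) (LinearMap.toSpanSingleton k _ 1)
          (TensorProduct.map (counit k V) (counit k V) z) := by
  induction z using TensorProduct.induction_on with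
  | zero => simp
  | tmul x y =>
    simp [incl_proj, TensorProduct.tmul_sub, TensorProduct.sub_tmul, smul_sub]
    abel
  | add x y hx hy => simp only [map_add, hx, hy]; abel

/-- Apply `map_incl_proj` to `Δ(x)`: the counit laws turn the two middle terms into `1 ⊗ x` and `x ⊗
1`, and the last one vanishes because `ε(x) = 0`. -/
lemma deconcat_incl (x : TPlus k V) :
    deconcat (incl k V x) = incl k V x ⊗ₜ 1 + 1 ⊗ₜ incl k V x +
      TensorProduct.map (incl k V) (incl k V) (reducedDeconcat k V x) := by
  have h : counit k V (incl k V x) = 0 := by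
    rw [← LinearMap.mem_ker, ← range_incl]
    exact ⟨x, rfl⟩
  have h' : TensorProduct.map (counit k V) (counit k V) (deconcat (incl k V x)) = 0 := by
    rw [← LinearMap.lTensor_comp_rTensor, LinearMap.comp_apply, rTensor_counit_deconcat]
    simp [h]
  have key := map_incl_proj (deconcat (incl k V x))
  rw [rTensor_counit_deconcat, lTensor_counit_deconcat, h', TensorProduct.map_comp] at key
  rw [reducedDeconcat, LinearMap.comp_apply, LinearMap.comp_apply,
    ← LinearMap.comp_apply (TensorProduct.map (incl k V) (incl k V)), key]
  simp only [TensorProduct.map_tmul, LinearMap.toSpanSingleton_apply, one_smul, map_zero,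
    LinearMap.id_apply, add_zero]
  abel

end Counit

end BraidedDendriform

end

theorem theorem4p1 {k : Type*} [Field k] [CharZero k] {V : Type*} [AddCommGroup V] [Module k V]
    (σ : V ⊗[k] V →ₗ[k] V ⊗[k] V) (hσ : BraidedDendriform.IsBraiding σ) :
    BraidedDendriform.IsBraidedDendriformHopf
      (BraidedDendriform.prec σ) (BraidedDendriform.succ σ)
      (BraidedDendriform.reducedDeconcat k V) (BraidedDendriform.braidTPlus σ) ∧
    -- `ε` is the counit of the deconcatenation coproduct `Δ` of `T(V)`, `T⁺(V)` is the kernel of `ε`,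
    -- and `Δ` and `Δ̄` correspond to each other
    (∀ t : TensorAlgebra k V,
      (BraidedDendriform.counit k V).rTensor _ (BraidedDendriform.deconcat t) = 1 ⊗ₜ t ∧
      (BraidedDendriform.counit k V).lTensor _ (BraidedDendriform.deconcat t) = t ⊗ₜ 1) ∧
    LinearMap.range (BraidedDendriform.incl k V) = LinearMap.ker (BraidedDendriform.counit k V) ∧
    (∀ x : BraidedDendriform.TPlus k V,
      BraidedDendriform.deconcat (BraidedDendriform.incl k V x) =
        BraidedDendriform.incl k V x ⊗ₜ 1 + 1 ⊗ₜ BraidedDendriform.incl k V x +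
        TensorProduct.map (BraidedDendriform.incl k V) (BraidedDendriform.incl k V)
          (BraidedDendriform.reducedDeconcat k V x)) := by
  exact ⟨BraidedDendriform.isBraidedDendriformHopf hσ, fun t =>
    ⟨BraidedDendriform.rTensor_counit_deconcat t, BraidedDendriform.lTensor_counit_deconcat t⟩,
    BraidedDendriform.range_incl, BraidedDendriform.deconcat_incl⟩
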